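/- **Theorem (Sobolev-type multi-order evolution equation, permutable case).** Let $X,Y$ be Banach spaces, $T>0$, $\mathbb J=[0,T]$, $1<\alpha\le 2$, $0<\beta\le 1$, $\eta,\hat\eta\in Y$, and let $g:\mathbb J\to Y$ be continuous. Let $E:D(E)\subset X\to Y$, $A_0:D(A_0)\subset X\to Y$, $B_0:D(B_0)\subset X\to Y$ be linear operators such that $A_0$ is closed; $B_0$ is bounded; $D(E)\subset D(A_0)$, $D(E)\subset D(B_0)$ and $E:D(E)\to Y$ is bijective; and $E^{-1}:Y\to X$ is compact. Then $A:=A_0E^{-1}$ and $B:=B_0E^{-1}$ are bounded operators on $Y$; assume $AB=BA$. Consider the Cauchy problem $$({}^{C}D^{\alpha}_{0+}Ey)(t)-A_0({}^{C}D^{\beta}_{0+}y)(t)=B_0y(t)+g(t)\quad(0<t\le T),\qquad Ey(0)=\eta,\quad Ey'(0)=\hat\eta. \tag{1}$$ Here $(I^{\nu}f)(t)=\frac1{\Gamma(\nu)}\int_0^t(t-s)^{\nu-1}f(s)\,ds$ for $\nu>0$, $I^0f=f$, and, for $n-1<\nu\le n$, ${}^{C}D^{\nu}_{0+}f=\frac{d^n}{dt^n}I^{n-\nu}\big(f-\sum_{k<n}\frac{t^k}{k!}f^{(k)}(0)\big)$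 (which is $I^{n-\nu}f^{(n)}$ when $f\in C^n$). A *mild solution* of (1) is a function $y=E^{-1}x$ on $\mathbb J$ with $x\in C(\mathbb J,Y)$ and, for all $t\in\mathbb J$, $$x(t)=\Big(I-\frac{t^{\alpha-\beta}}{\Gamma(\alpha-\beta+1)}A\Big)\eta+t\hat\eta+\frac{A}{\Gamma(\alpha-\beta)}\int_0^t(t-r)^{\alpha-\beta-1}x(r)\,dr+\frac1{\Gamma(\alpha)}\int_0^t(t-r)^{\alpha-1}\big(Bx(r)+g(r)\big)dr .$$ For $a,b>0$ put $E_{a,b,c}(At^{a},Bt^{b})=\sum_{k=0}^\infty\sum_{m=0}^\infty\binom{k+m}{m}A^kB^m\frac{t^{ka+mb}}{\Gamma(ka+mb+c)}$. For $t\in\mathbb J$ let $$\begin{aligned}\hat y(t)&=\big(E^{-1}+t^{\alpha}E^{-1}BE_{\alpha-\beta,\alpha,\alpha+1}(At^{\alpha-\beta},Bt^{\alpha})\big)\eta+tE^{-1}E_{\alpha-\beta,\alpha,2}(At^{\alpha-\beta},Bt^{\alpha})\hat\eta\\&\quad+\int_0^t(t-s)^{\alpha-1}E^{-1}E_{\alpha-\beta,\alpha,\alpha}(A(t-s)^{\alpha-\beta},B(t-s)^{\alpha})g(s)\,ds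 .\end{aligned}$$ Then: 1. For every $t\in\mathbb J$ all series involved converge absolutely in operator norm, the integrand is integrable, and $$\begin{aligned}\hat y(t)&=\Big(E^{-1}+\sum_{k,m\ge0}\tbinom{k+m}{m}E^{-1}A^kB^{m+1}\tfrac{t^{k(\alpha-\beta)+m\alpha+\alpha}}{\Gamma(k(\alpha-\beta)+m\alpha+\alpha+1)}\Big)\eta+\sum_{k,m\ge0}\tbinom{k+m}{m}E^{-1}A^kB^{m}\tfrac{t^{k(\alpha-\beta)+m\alpha+1}}{\Gamma(k(\alpha-\beta)+m\alpha+2)}\hat\eta\\&\quad+\int_0^t\sum_{k,m\ge0}\tbinom{k+m}{m}E^{-1}A^kB^{m}\tfrac{(t-s)^{k(\alpha-\beta)+m\alpha+\alpha-1}}{\Gamma(k(\alpha-\beta)+m\alpha+\alpha)}g(s)\,ds .\end{aligned}$$ 2. A function $y:\mathbb J\to X$ is a mild solution of (1) if and only if $y=\hat y$ on $\mathbb J$. 3. A function $y:\mathbb J\to X$ with values in $D(E)$ and $Ey\in C^1(\mathbb J,Y)$ for which both Caputo derivatives in (1) exist on $(0,T]$ satisfies (1) if and only if $y=\hat y$ on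 $\mathbb J$; in particular $\hat y$ is such a function. 4. A function $y\in C^2(\mathbb J,X)$ with values in $D(E)$ and $Ey\in C^2(\mathbb J,Y)$ satisfies (1), with the Caputo derivatives $I^{n-\nu}f^{(n)}$, if and only if $y=\hat y$ on $\mathbb J$. -/

import Mathlib

noncomputable section

/-- The Riemann–Liouville fractional integral `I^ν_{0+} f` of order `ν ≥ 0` (Bochner integral),
with the usual convention that `I^0` is the identity. -/
def fracIntegral {F : Type*} [NormedAddCommGroup F] [NormedSpace ℝ F]
    (ν : ℝ) (f : ℝ → F) (t : ℝ) : F :=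
  if ν = 0 then f t
  else (1 / Real.Gamma ν) • ∫ s in (0 : ℝ)..t, (t - s) ^ (ν - 1) • f s

/-- The Caputo derivative of order `n - 1 < ν ≤ n` (so `n = ⌈ν⌉`) of a function of class `C^n` on
`[0, T]`: the fractional integral of order `n - ν` of the `n`-th derivative. -/
def caputoDeriv {F : Type*} [NormedAddCommGroup F] [NormedSpace ℝ F]
    (T ν : ℝ) (f : ℝ → F) (t : ℝ) : F :=
  fracIntegral ((⌈ν⌉₊ : ℝ) - ν) (iteratedDerivWithin ⌈ν⌉₊ f (Set.Icc 0 T)) t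

/-- `I^(n - ν) (f - ∑_{k < n} t^k / k! • f^(k)(0))` with `n = ⌈ν⌉`: the function whose `n`-th
derivative is the Caputo derivative of `f`, in its definition through the Riemann–Liouville
derivative. -/
def caputoPrimitive {F : Type*} [NormedAddCommGroup F] [NormedSpace ℝ F]
    (T ν : ℝ) (f : ℝ → F) : ℝ → F :=
  fracIntegral ((⌈ν⌉₊ : ℝ) - ν) (fun t => f t -
    ∑ k ∈ Finset.range ⌈ν⌉₊, (t ^ k / (k.factorial : ℝ)) • iteratedDerivWithin k f (Set.Icc 0 T) 0)

/-- The Caputo derivative of order `ν` of `f` on `[0, T]`, defined through the Riemann–Liouville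
derivative of `f` minus its Taylor polynomial at `0`, exists at `t` and has the value `v`. -/
def HasCaputoDerivAt {F : Type*} [NormedAddCommGroup F] [NormedSpace ℝ F]
    (T ν : ℝ) (f : ℝ → F) (v : F) (t : ℝ) : Prop :=
  ContDiffOn ℝ ((⌈ν⌉₊ - 1 : ℕ) : WithTop ℕ∞) (caputoPrimitive T ν f) (Set.Icc 0 T) ∧
  HasDerivWithinAt (iteratedDerivWithin (⌈ν⌉₊ - 1) (caputoPrimitive T ν f) (Set.Icc 0 T)) v
    (Set.Icc 0 T) t

/-- The `(k, m)` term of the bivariate Mittag-Leffler series. -/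
def bivariateMLTerm {Y : Type*} [NormedAddCommGroup Y] [NormedSpace ℝ Y]
    (A B : Y →L[ℝ] Y) (a b c t : ℝ) (k m : ℕ) : Y →L[ℝ] Y :=
  (((k + m).choose m : ℝ) * (t ^ (k * a + m * b) / Real.Gamma (k * a + m * b + c))) •
    (A ^ k * B ^ m)

/-- The operator-valued bivariate Mittag-Leffler function `E_{a,b,c}(A t^a, B t^b)`
of commuting bounded operators `A`, `B`; the series is taken in operator norm. -/
def bivariateML {Y : Type*} [NormedAddCommGroup Y] [NormedSpace ℝ Y]
    (A B : Y →L[ℝ] Y) (a b c t : ℝ) : Y →L[ℝ] Y :=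
  ∑' k : ℕ, ∑' m : ℕ, bivariateMLTerm A B a b c t k m

/-- The hypotheses on the partially defined linear operators `E`, `A₀`, `B₀` from `X` to `Y`.
Boundedness of `B₀` is boundedness on its domain; `D(E) ⊆ D(B₀)` is automatic when `B₀` is
everywhere defined. -/
structure SobolevHypotheses {X Y : Type*} [NormedAddCommGroup X] [NormedSpace ℝ X]
    [NormedAddCommGroup Y] [NormedSpace ℝ Y] (E A₀ B₀ : X →ₗ.[ℝ] Y) : Prop where
  closed_A₀ : A₀.IsClosed
  bounded_B₀ : ∃ C : ℝ, ∀ x : B₀.domain, ‖B₀ x‖ ≤ C * ‖(x : X)‖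
  domain_E_le_A₀ : E.domain ≤ A₀.domain
  domain_E_le_B₀ : E.domain ≤ B₀.domain
  bijective_E : Function.Bijective E.toFun
  compact_inv : IsCompactOperator
    (fun z : Y => (((LinearEquiv.ofBijective E.toFun bijective_E).symm z : E.domain) : X))

namespace SobolevHypotheses

variable {X Y : Type*} [NormedAddCommGroup X] [NormedSpace ℝ X]
  [NormedAddCommGroup Y] [NormedSpace ℝ Y] {E A₀ B₀ : X →ₗ.[ℝ] Y}

/-- `E⁻¹ : Y → D(E)` as a linear equivalence. -/
def invDomain (h : SobolevHypotheses E A₀ B₀) : Y ≃ₗ[ℝ] E.domain :=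
  (LinearEquiv.ofBijective E.toFun h.bijective_E).symm

/-- `E⁻¹ : Y → X`, a bounded operator (because it is compact). -/
def inv (h : SobolevHypotheses E A₀ B₀) : Y →L[ℝ] X where
  toLinearMap := E.domain.subtype ∘ₗ h.invDomain.toLinearMap
  cont := IsCompactOperator.continuous
    (f := E.domain.subtype ∘ₗ h.invDomain.toLinearMap) h.compact_inv

/-- `B = B₀ E⁻¹`, a bounded operator on `Y`. -/
def opB (h : SobolevHypotheses E A₀ B₀) : Y →L[ℝ] Y where
  toLinearMap := B₀.toFun ∘ₗ Submodule.inclusion h.domain_E_le_B₀ ∘ₗ h.invDomain.toLinearMap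
  cont := by
    obtain ⟨C, hC⟩ := h.bounded_B₀
    refine AddMonoidHomClass.continuous_of_bound
      (B₀.toFun ∘ₗ Submodule.inclusion h.domain_E_le_B₀ ∘ₗ h.invDomain.toLinearMap)
      (|C| * ‖h.inv‖) fun z => ?_
    calc _ ≤ C * ‖h.inv z‖ := hC (Submodule.inclusion h.domain_E_le_B₀ (h.invDomain z))
      _ ≤ |C| * ‖h.inv z‖ := by gcongr; exact le_abs_self C
      _ ≤ |C| * (‖h.inv‖ * ‖z‖) := by gcongr; exact h.inv.le_opNorm z
      _ = _ := by ring

/-- `A = A₀ E⁻¹`, a bounded operator on `Y` by the closed graph theorem. -/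
def opA [CompleteSpace Y] (h : SobolevHypotheses E A₀ B₀) : Y →L[ℝ] Y where
  toLinearMap := A₀.toFun ∘ₗ Submodule.inclusion h.domain_E_le_A₀ ∘ₗ h.invDomain.toLinearMap
  cont := by
    apply LinearMap.continuous_of_isClosed_graph
    have hc : IsClosed (A₀.graph : Set (X × Y)) := h.closed_A₀
    have hp := hc.preimage ((h.inv.continuous.comp continuous_fst).prodMk continuous_snd :
      Continuous fun p : Y × Y => (h.inv p.1, p.2))
    convert hp using 1
    ext ⟨z, w⟩
    simp only [SetLike.mem_coe, LinearMap.mem_graph_iff, Set.mem_preimage,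
      LinearPMap.mem_graph_iff]
    constructor
    · intro hw
      exact ⟨Submodule.inclusion h.domain_E_le_A₀ (h.invDomain z), rfl, hw.symm⟩
    · rintro ⟨u, hu, rfl⟩
      have : u = Submodule.inclusion h.domain_E_le_A₀ (h.invDomain z) := Subtype.ext hu
      rw [this]; rfl

end SobolevHypotheses

/-- `y = E⁻¹ x` on `[0, T]`, where `x` is a continuous solution of the Volterra integral equation
that is the integrated form of `ᶜD^α x - A ᶜD^β x = B x + g`, `x 0 = η`, `x' 0 = η'`,
with `A = A₀ E⁻¹`, `B = B₀ E⁻¹`. -/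
def IsMildSolution {X Y : Type*} [NormedAddCommGroup X] [NormedSpace ℝ X]
    [NormedAddCommGroup Y] [NormedSpace ℝ Y] [CompleteSpace Y] {E A₀ B₀ : X →ₗ.[ℝ] Y}
    (h : SobolevHypotheses E A₀ B₀) (T α β : ℝ) (η η' : Y) (g : ℝ → Y) (y : ℝ → X) : Prop :=
  ∃ x : ℝ → Y, ContinuousOn x (Set.Icc 0 T) ∧
    (∀ t ∈ Set.Icc 0 T, y t = h.inv (x t)) ∧
    ∀ t ∈ Set.Icc 0 T,
      x t = η - (t ^ (α - β) / Real.Gamma (α - β + 1)) • h.opA η + t • η'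
        + h.opA (fracIntegral (α - β) x t)
        + fracIntegral α (fun r => h.opB (x r) + g r) t

/-- `y` solves `ᶜD^α (E y) - A₀ ᶜD^β y = B₀ y + g` on `(0, T]`, `E y(0) = η`, `E y'(0) = η'`,
with `E y` of class `C¹` on `[0, T]` and Caputo derivatives defined through Riemann–Liouville
derivatives. Membership `(u, v) ∈ L.graph` means `u ∈ D(L)` and `L u = v`; `x` is `E y`. -/
def IsCaputoSolution {X Y : Type*} [NormedAddCommGroup X] [NormedSpace ℝ X]
    [NormedAddCommGroup Y] [NormedSpace ℝ Y] (E A₀ B₀ : X →ₗ.[ℝ] Y)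
    (T α β : ℝ) (η η' : Y) (g : ℝ → Y) (y : ℝ → X) : Prop :=
  ∃ x : ℝ → Y, (∀ t ∈ Set.Icc 0 T, (y t, x t) ∈ E.graph) ∧
    ContDiffOn ℝ 1 x (Set.Icc 0 T) ∧
    (y 0, η) ∈ E.graph ∧ (derivWithin y (Set.Icc 0 T) 0, η') ∈ E.graph ∧
    ∀ t ∈ Set.Ioc 0 T, ∃ (u : X) (v a b : Y),
      HasCaputoDerivAt T β y u t ∧ HasCaputoDerivAt T α x v t ∧
      (u, a) ∈ A₀.graph ∧ (y t, b) ∈ B₀.graph ∧ v - a = b + g t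

/-- `y` is of class `C²` on `[0, T]` and solves the same Cauchy problem with `E y` of class `C²`
and the Caputo derivatives `I^(n - ν) f^(n)`. -/
def IsC2Solution {X Y : Type*} [NormedAddCommGroup X] [NormedSpace ℝ X]
    [NormedAddCommGroup Y] [NormedSpace ℝ Y] (E A₀ B₀ : X →ₗ.[ℝ] Y)
    (T α β : ℝ) (η η' : Y) (g : ℝ → Y) (y : ℝ → X) : Prop :=
  ContDiffOn ℝ 2 y (Set.Icc 0 T) ∧
  ∃ x : ℝ → Y, (∀ t ∈ Set.Icc 0 T, (y t, x t) ∈ E.graph) ∧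
    ContDiffOn ℝ 2 x (Set.Icc 0 T) ∧
    (y 0, η) ∈ E.graph ∧ (derivWithin y (Set.Icc 0 T) 0, η') ∈ E.graph ∧
    ∀ t ∈ Set.Ioc 0 T, ∃ a b : Y,
      (caputoDeriv T β y t, a) ∈ A₀.graph ∧ (y t, b) ∈ B₀.graph ∧
      caputoDeriv T α x t - a = b + g t

/-- The closed formula
`(E⁻¹ + t^α E⁻¹ B E_{α-β,α,α+1}) η + t E⁻¹ E_{α-β,α,2} η' + (t^(α-1) E⁻¹ E_{α-β,α,α}) ∗ g`. -/
def mlFormula {X Y : Type*} [NormedAddCommGroup X] [NormedSpace ℝ X]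
    [NormedAddCommGroup Y] [NormedSpace ℝ Y] (J : Y →L[ℝ] X) (A B : Y →L[ℝ] Y)
    (α β : ℝ) (η η' : Y) (g : ℝ → Y) (t : ℝ) : X :=
  (J + t ^ α • (J ∘L B ∘L bivariateML A B (α - β) α (α + 1) t)) η
    + t • J (bivariateML A B (α - β) α 2 t η')
    + ∫ s in (0 : ℝ)..t, (t - s) ^ (α - 1) • J (bivariateML A B (α - β) α α (t - s) (g s))

/-- The term `binom(k+m, m) t^(k(α-β) + mα + c - 1) / Γ(k(α-β) + mα + c) E⁻¹ A^k B^n`. -/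
def seriesTerm {X Y : Type*} [NormedAddCommGroup X] [NormedSpace ℝ X]
    [NormedAddCommGroup Y] [NormedSpace ℝ Y] (J : Y →L[ℝ] X) (A B : Y →L[ℝ] Y)
    (α β c t : ℝ) (n k m : ℕ) : Y →L[ℝ] X :=
  (((k + m).choose m : ℝ) *
    (t ^ (k * (α - β) + m * α + c - 1) / Real.Gamma (k * (α - β) + m * α + c))) •
    (J ∘L (A ^ k * B ^ n))

/-- The same formula with the double series written out. -/
def seriesFormula {X Y : Type*} [NormedAddCommGroup X] [NormedSpace ℝ X]
    [NormedAddCommGroup Y] [NormedSpace ℝ Y] (J : Y →L[ℝ] X) (A B : Y →L[ℝ] Y)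
    (α β : ℝ) (η η' : Y) (g : ℝ → Y) (t : ℝ) : X :=
  (J + ∑' k : ℕ, ∑' m : ℕ, seriesTerm J A B α β (α + 1) t (m + 1) k m) η
    + (∑' k : ℕ, ∑' m : ℕ, seriesTerm J A B α β 2 t m k m) η'
    + ∫ s in (0 : ℝ)..t, (∑' k : ℕ, ∑' m : ℕ, seriesTerm J A B α β α (t - s) m k m) (g s)

end

/-! With `x = E y` everything takes place in `Y`, where `A = A₀E⁻¹` and `B = B₀E⁻¹` are bounded, and
the integrated problem is the Volterra equation `x = η + tη' + A I^(α-β)(x - η) + I^α(Bx + g)`. The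
term with `t^(α-β)` in the mild formulation is just `A I^(α-β) η`. For `u = x - η` this reads `u = f
+ Pu + Qu` on `C([0,T], Y)`, with `P = A I^(α-β)`, `Q = B I^α` and `f = I^α(Bη + g) + I^1 η'`.

Fractional integrals form a semigroup (`fracOp_fracOp`) and commute with operators acting pointwise,
so `P` and `Q` commute and `P^k Q^m = A^k B^m I^(k(α-β)+mα)`. The norm of `I^ν` is at most `T^ν /
Γ(ν+1)`, and Gamma outgrows every exponential (`rpow_mul_le_Gamma`); hence the binomial double
series for `∑ (P+Q)^n` converges absolutely and inverts `1 - P - Q` with no smallness assumption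
(`exists_volterra`). Evaluating it on the three parts of `f` produces the three Mittag-Leffler
expressions (`hasSum_neumann_mildFormula`).

For the Cauchy problem itself, write `x = η + I^1 w`. Injectivity of `I^1` turns the Volterra
equation into `w - η' = I^(α-1) v` with `v = A I^(1-β) w + Bx + g`
(`isVolterraSolution_iff_derivative`). The Caputo derivative of order `β` is `I^(1-β) w`, that of
order `α` is the derivative of `I^(2-α)(w - w(0))`, so the Cauchy problem says `I^(2-α)(w - η') =
I^1 v`: the same equation after applying the injective `I^(2-α)` (`fracOp_injective`). That a
Volterra solution is automatically `C¹` is `IsVolterraSolution.exists_derivative`. -/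

noncomputable section

open Set MeasureTheory
open scoped Topology

/-! ### Fractional integrals as bounded operators on `C([0,T], F)` -/

section FracIntegral

variable {F G : Type*} [NormedAddCommGroup F] [NormedSpace ℝ F]
  [NormedAddCommGroup G] [NormedSpace ℝ G]

lemma fracIntegral_zero (f : ℝ → F) (t : ℝ) : fracIntegral 0 f t = f t := by
  simp [fracIntegral]

lemma fracIntegral_congr {ν T t : ℝ} {f g : ℝ → F} (hfg : EqOn f g (Icc 0 T))
    (ht : t ∈ Icc 0 T) : fracIntegral ν f t = fracIntegral ν g t := by
  unfold fracIntegral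
  split_ifs
  · exact hfg ht
  · congr 1
    refine intervalIntegral.integral_congr fun s hs => ?_
    rw [uIcc_of_le ht.1] at hs
    simp only [hfg ⟨hs.1, hs.2.trans ht.2⟩]

lemma intervalIntegrable_one_sub_rpow {ν : ℝ} (hν : 0 < ν) :
    IntervalIntegrable (fun u : ℝ => (1 - u) ^ (ν - 1)) volume 0 1 := by
  have := (intervalIntegral.intervalIntegrable_rpow' (a := 0) (b := 1)
    (show -1 < ν - 1 by linarith)).comp_sub_left 1
  simpa using this.symm

lemma integral_one_sub_rpow {ν : ℝ} (hν : 0 < ν) :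
    ∫ u in (0 : ℝ)..1, (1 - u) ^ (ν - 1) = 1 / ν := by
  rw [intervalIntegral.integral_comp_sub_left (fun u : ℝ => u ^ (ν - 1)) 1,
    integral_rpow (Or.inl (by linarith))]
  simp [hν.ne']

/-- The fractional integral as an integral over the unit interval. -/
lemma fracIntegral_eq_unitInterval {ν t : ℝ} (hν : 0 < ν) (ht : 0 ≤ t) (f : ℝ → F) :
    fracIntegral ν f t =
      (t ^ ν / Real.Gamma ν) • ∫ u in (0 : ℝ)..1, (1 - u) ^ (ν - 1) • f (t * u) := by
  rw [fracIntegral, if_neg hν.ne']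
  rcases ht.eq_or_lt with rfl | ht'
  · simp [Real.zero_rpow hν.ne']
  · have h1 := intervalIntegral.integral_comp_mul_left (a := 0) (b := 1)
      (fun s => (t - s) ^ (ν - 1) • f s) ht'.ne'
    simp only [mul_zero, mul_one] at h1
    have h2 : ∫ u in (0 : ℝ)..1, (t - t * u) ^ (ν - 1) • f (t * u)
        = t ^ (ν - 1) • ∫ u in (0 : ℝ)..1, (1 - u) ^ (ν - 1) • f (t * u) := by
      rw [← intervalIntegral.integral_smul]
      refine intervalIntegral.integral_congr fun u hu => ?_
      rw [uIcc_of_le zero_le_one] at hu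
      simp only [smul_smul]
      rw [← Real.mul_rpow ht (sub_nonneg.2 hu.2), mul_sub, mul_one]
    rw [h2] at h1
    have h3 : ∫ s in (0 : ℝ)..t, (t - s) ^ (ν - 1) • f s
        = t ^ ν • ∫ u in (0 : ℝ)..1, (1 - u) ^ (ν - 1) • f (t * u) := by
      rw [← inv_smul_smul₀ ht'.ne' (∫ s in (0 : ℝ)..t, (t - s) ^ (ν - 1) • f s), ← smul_comm, ← h1,
        smul_smul]
      congr 1
      rw [Real.rpow_sub ht', Real.rpow_one]
      field_simp
    rw [h3, smul_smul]
    congr 1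
    ring

/-- On the unit interval `t` enters only through `f (t * u)`, so the singular kernel is a fixed
integrable weight and dominated convergence applies even for `ν < 1`. -/
lemma continuous_unitInterval_integral {ν M : ℝ} (hν : 0 < ν) {f : ℝ → F} (hf : Continuous f)
    (hM : ∀ s, ‖f s‖ ≤ M) :
    Continuous fun t : ℝ => ∫ u in (0 : ℝ)..1, (1 - u) ^ (ν - 1) • f (t * u) := by
  refine intervalIntegral.continuous_of_dominated_interval
    (bound := fun u => (1 - u) ^ (ν - 1) * M) (fun t => ?_) (fun t => ?_) ?_ ?_
  · exact (((measurable_const.sub measurable_id).pow_const _).aestronglyMeasurable).smul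
      (hf.comp (continuous_const.mul continuous_id)).aestronglyMeasurable
  · refine Filter.Eventually.of_forall fun u hu => ?_
    rw [uIoc_of_le zero_le_one] at hu
    have : 0 ≤ (1 - u) ^ (ν - 1) := Real.rpow_nonneg (sub_nonneg.2 hu.2) _
    rw [norm_smul, Real.norm_of_nonneg this]
    gcongr
    exact hM _
  · exact (intervalIntegrable_one_sub_rpow hν).mul_const M
  · refine Filter.Eventually.of_forall fun u _ => ?_
    exact continuous_const.smul (hf.comp (continuous_id.mul continuous_const))

lemma intervalIntegrable_unitInterval {ν : ℝ} (hν : 0 < ν) {f : ℝ → F} (hf : Continuous f)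
    (t : ℝ) : IntervalIntegrable (fun u => (1 - u) ^ (ν - 1) • f (t * u)) volume 0 1 :=
  (intervalIntegrable_one_sub_rpow hν).smul_continuousOn
    (hf.comp (continuous_const.mul continuous_id)).continuousOn

variable {T : ℝ} (hT : 0 ≤ T)

omit [NormedSpace ℝ F] in
lemma norm_iccExtend_le (f : C(Icc 0 T, F)) (s : ℝ) : ‖IccExtend hT f s‖ ≤ ‖f‖ :=
  f.norm_coe_le_norm _

/-- The factor `1 / Γ(ν + 1)` is what later makes the Neumann series converge on an interval of any
length. -/
lemma norm_fracIntegral_le {ν t : ℝ} (hν : 0 < ν) (ht : t ∈ Icc 0 T) (f : C(Icc 0 T, F)) :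
    ‖fracIntegral ν (IccExtend hT f) t‖ ≤ T ^ ν / Real.Gamma (ν + 1) * ‖f‖ := by
  rw [fracIntegral_eq_unitInterval hν ht.1, norm_smul,
    Real.norm_of_nonneg (div_nonneg (Real.rpow_nonneg ht.1 _) (Real.Gamma_pos_of_pos hν).le)]
  have h1 : ‖∫ u in (0 : ℝ)..1, (1 - u) ^ (ν - 1) • IccExtend hT f (t * u)‖
      ≤ ∫ u in (0 : ℝ)..1, (1 - u) ^ (ν - 1) * ‖f‖ := by
    refine intervalIntegral.norm_integral_le_of_norm_le zero_le_one
      (Filter.Eventually.of_forall fun u hu => ?_)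
      ((intervalIntegrable_one_sub_rpow hν).mul_const _)
    have : 0 ≤ (1 - u) ^ (ν - 1) := Real.rpow_nonneg (sub_nonneg.2 hu.2) _
    rw [norm_smul, Real.norm_of_nonneg this]
    gcongr
    exact norm_iccExtend_le hT f _
  rw [intervalIntegral.integral_mul_const, integral_one_sub_rpow hν] at h1
  have hG := Real.Gamma_pos_of_pos hν
  calc _ ≤ T ^ ν / Real.Gamma ν * (1 / ν * ‖f‖) := by
        gcongr
        · exact ht.1
        · exact ht.2
    _ = _ := by rw [Real.Gamma_add_one hν.ne']; field_simp

lemma continuous_fracIntegral {ν : ℝ} (hν : 0 < ν) (f : C(Icc 0 T, F)) :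
    Continuous fun t : Icc 0 T => fracIntegral ν (IccExtend hT f) t := by
  have : (fun t : Icc 0 T => fracIntegral ν (IccExtend hT f) t) = fun t : Icc 0 T =>
      ((t : ℝ) ^ ν / Real.Gamma ν) •
        ∫ u in (0 : ℝ)..1, (1 - u) ^ (ν - 1) • IccExtend hT f (t * u) :=
    funext fun t => fracIntegral_eq_unitInterval hν t.2.1 _
  rw [this]
  refine ((continuous_subtype_val.rpow_const fun _ => Or.inr hν.le).div_const _).smul ?_
  exact (continuous_unitInterval_integral hν f.continuous.Icc_extend'
    (norm_iccExtend_le hT f)).comp continuous_subtype_val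

/-- The fractional integral of order `ν ≥ 0` as a bounded operator on `C([0, T], F)`. -/
def fracOp (ν : ℝ) : C(Icc 0 T, F) →L[ℝ] C(Icc 0 T, F) :=
  if hν : 0 < ν then
    LinearMap.mkContinuous
      { toFun := fun f => ⟨fun t => fracIntegral ν (IccExtend hT f) t, continuous_fracIntegral hT hν f⟩
        map_add' := fun f g => by
          ext t
          simp only [ContinuousMap.coe_mk, ContinuousMap.add_apply]
          simp only [fracIntegral_eq_unitInterval hν t.2.1]
          rw [← smul_add, ← intervalIntegral.integral_add
            (intervalIntegrable_unitInterval hν f.continuous.Icc_extend' _)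
            (intervalIntegrable_unitInterval hν g.continuous.Icc_extend' _)]
          simp [IccExtend]
        map_smul' := fun c f => by
          ext t
          simp only [ContinuousMap.coe_mk, ContinuousMap.smul_apply, RingHom.id_apply]
          simp only [fracIntegral_eq_unitInterval hν t.2.1]
          rw [smul_comm c, ← intervalIntegral.integral_smul c]
          congr 2 with u
          exact smul_comm _ _ _ }
      (T ^ ν / Real.Gamma (ν + 1)) fun f => by
        rw [ContinuousMap.norm_le _ (by have := Real.Gamma_pos_of_pos (add_pos hν one_pos); positivity)]
        exact fun t => norm_fracIntegral_le hT hν t.2 f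
  -- The identity is the right value at `ν = 0`, so the endpoint orders `α = 2` and `β = 1` need no
  -- separate formulas.
  else 1

lemma fracOp_zero : fracOp (F := F) hT 0 = 1 := by simp [fracOp]

lemma fracOp_apply {ν : ℝ} (hν : 0 ≤ ν) (f : C(Icc 0 T, F)) (t : Icc 0 T) :
    fracOp hT ν f t = fracIntegral ν (IccExtend hT f) t := by
  rcases hν.eq_or_lt with rfl | hν
  · simp [fracOp_zero, fracIntegral_zero, IccExtend]
  · simp [fracOp, hν]

lemma norm_fracOp_le {ν : ℝ} (hν : 0 ≤ ν) :
    ‖fracOp (F := F) hT ν‖ ≤ T ^ ν / Real.Gamma (ν + 1) := by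
  rcases hν.eq_or_lt with rfl | hν
  · rw [fracOp_zero]
    rw [Real.rpow_zero, zero_add, Real.Gamma_one, div_one]
    exact ContinuousLinearMap.norm_id_le
  · rw [fracOp, dif_pos hν]
    exact LinearMap.mkContinuous_norm_le _
      (by have := Real.Gamma_pos_of_pos (add_pos hν one_pos); positivity) _

/-- The restriction to `[0, T]` of a function on the real line. -/
def restrictIcc (f : ℝ → F) (hf : ContinuousOn f (Icc 0 T)) : C(Icc 0 T, F) :=
  ⟨fun t => f t, hf.domRestrict⟩

omit [NormedSpace ℝ F] in
lemma restrictIcc_apply (f : ℝ → F) (hf : ContinuousOn f (Icc 0 T)) (t : Icc 0 T) :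
    restrictIcc f hf t = f t := rfl

/-- `fracOp` in terms of a function on the real line. -/
lemma fracOp_restrict_apply {ν : ℝ} (hν : 0 ≤ ν) {f : ℝ → F} (hf : ContinuousOn f (Icc 0 T))
    {t : ℝ} (ht : t ∈ Icc 0 T) :
    fracOp hT ν (restrictIcc f hf) ⟨t, ht⟩ = fracIntegral ν f t := by
  rw [fracOp_apply hT hν]
  exact fracIntegral_congr (fun s hs => by rw [IccExtend_of_mem _ _ hs, restrictIcc_apply]) ht

lemma fracOp_apply_zero {ν : ℝ} (hν : 0 < ν) (f : C(Icc 0 T, F)) :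
    fracOp hT ν f ⟨0, left_mem_Icc.2 hT⟩ = 0 := by
  rw [fracOp_apply hT hν.le, fracIntegral_eq_unitInterval hν le_rfl]
  simp [Real.zero_rpow hν.ne']

lemma fracOp_const_apply {ν : ℝ} (hν : 0 ≤ ν) (c : F) [CompleteSpace F] (t : Icc 0 T) :
    fracOp hT ν (ContinuousMap.const _ c) t = ((t : ℝ) ^ ν / Real.Gamma (ν + 1)) • c := by
  rw [fracOp_apply hT hν]
  rcases hν.eq_or_lt with rfl | hν
  · simp [fracIntegral_zero, IccExtend]
  · rw [fracIntegral_eq_unitInterval hν t.2.1]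
    simp only [IccExtend, ContinuousMap.coe_const, Function.comp_def, Function.const_apply]
    rw [intervalIntegral.integral_smul_const, integral_one_sub_rpow hν, smul_smul,
      Real.Gamma_add_one hν.ne']
    congr 1
    field_simp

/-- Postcomposition with a bounded operator commutes with fractional integration. -/
lemma compLeft_fracOp [CompleteSpace F] [CompleteSpace G] (L : F →L[ℝ] G) {ν : ℝ} (hν : 0 ≤ ν)
    (f : C(Icc 0 T, F)) :
    L.compLeftContinuous ℝ _ (fracOp hT ν f) = fracOp hT ν (L.compLeftContinuous ℝ _ f) := by
  ext t
  rcases hν.eq_or_lt with rfl | hν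
  · simp [fracOp_zero]
  · rw [fracOp_apply hT hν.le, fracIntegral_eq_unitInterval hν t.2.1]
    change L (fracOp hT ν f t) = _
    rw [fracOp_apply hT hν.le, fracIntegral_eq_unitInterval hν t.2.1, map_smul,
      ← ContinuousLinearMap.intervalIntegral_comp_comm L
        (intervalIntegrable_unitInterval hν f.continuous.Icc_extend' _)]
    congr 2 with u
    exact map_smul L _ _

end FracIntegral

/-! ### Semigroup law and fundamental theorem of calculus -/

section Semigroup

/-- Euler's Beta integral `B(p + 1, ν)`; real and complex powers agree here because both bases are
nonnegative on `[0, 1]`. -/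
lemma integral_one_sub_rpow_mul_rpow {ν p : ℝ} (hν : 0 < ν) (hp : 0 ≤ p) :
    ∫ u in (0 : ℝ)..1, (1 - u) ^ (ν - 1) * u ^ p
      = Real.Gamma ν * Real.Gamma (p + 1) / Real.Gamma (p + 1 + ν) := by
  have h := ProbabilityTheory.beta_eq_betaIntegralReal (p + 1) ν (by linarith) hν
  rw [ProbabilityTheory.beta] at h
  rw [mul_comm (Real.Gamma ν), h, Complex.betaIntegral]
  have : ∫ x in (0 : ℝ)..1, (x : ℂ) ^ (((p + 1 : ℝ) : ℂ) - 1) * (1 - (x : ℂ)) ^ ((ν : ℂ) - 1)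
      = ∫ u in (0 : ℝ)..1, (((1 - u) ^ (ν - 1) * u ^ p : ℝ) : ℂ) := by
    refine intervalIntegral.integral_congr fun u hu => ?_
    rw [uIcc_of_le zero_le_one] at hu
    rw [mul_comm, Complex.ofReal_mul, Complex.ofReal_cpow (sub_nonneg.2 hu.2),
      Complex.ofReal_cpow hu.1]
    push_cast
    simp
  rw [this, intervalIntegral.integral_ofReal, Complex.ofReal_re]

lemma fracIntegral_rpow {ν p t : ℝ} (hν : 0 ≤ ν) (hp : 0 ≤ p) (ht : 0 ≤ t) :
    fracIntegral ν (fun s : ℝ => s ^ p) t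
      = Real.Gamma (p + 1) / Real.Gamma (p + 1 + ν) * t ^ (p + ν) := by
  rcases hν.eq_or_lt with rfl | hν
  · rw [fracIntegral_zero, add_zero, add_zero,
      div_self (Real.Gamma_pos_of_pos (by linarith)).ne', one_mul]
  · rw [fracIntegral_eq_unitInterval hν ht]
    have : ∫ u in (0 : ℝ)..1, (1 - u) ^ (ν - 1) • (t * u) ^ p
        = t ^ p * ∫ u in (0 : ℝ)..1, (1 - u) ^ (ν - 1) * u ^ p := by
      rw [← intervalIntegral.integral_const_mul]
      refine intervalIntegral.integral_congr fun u hu => ?_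
      rw [uIcc_of_le zero_le_one] at hu
      simp only [smul_eq_mul]
      rw [Real.mul_rpow ht hu.1]
      ring
    rw [this, integral_one_sub_rpow_mul_rpow hν hp, smul_eq_mul,
      Real.rpow_add_of_nonneg ht hp hν.le]
    have := (Real.Gamma_pos_of_pos hν).ne'
    field_simp

variable {T : ℝ} (hT : 0 ≤ T)

/-- The function `t ↦ t ^ p` on `[0, T]`. -/
def rpowMap (T : ℝ) {p : ℝ} (hp : 0 ≤ p) : C(Icc 0 T, ℝ) :=
  restrictIcc (fun t => t ^ p) (Real.continuous_rpow_const hp).continuousOn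

lemma fracOp_rpowMap {ν p : ℝ} (hν : 0 ≤ ν) (hp : 0 ≤ p) :
    fracOp hT ν (rpowMap T hp)
      = (Real.Gamma (p + 1) / Real.Gamma (p + 1 + ν)) • rpowMap T (add_nonneg hp hν) := by
  ext t
  rw [rpowMap, fracOp_restrict_apply hT hν _ t.2, fracIntegral_rpow hν hp t.2.1]
  rfl

/-- The difference of the two sides is a bounded operator, so its kernel is closed. It contains the
monomials, where Gamma factors cancel, hence by Weierstrass everything. No exchange of integrals is
needed. -/
lemma fracOp_semigroup_real {μ ν : ℝ} (hμ : 0 ≤ μ) (hν : 0 ≤ ν) (f : C(Icc 0 T, ℝ)) :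
    fracOp hT μ (fracOp hT ν f) = fracOp hT (μ + ν) f := by
  set D : C(Icc 0 T, ℝ) →L[ℝ] C(Icc 0 T, ℝ) :=
    fracOp hT μ ∘L fracOp hT ν - fracOp hT (μ + ν) with hD
  suffices h : f ∈ LinearMap.ker D.toLinearMap by
    simpa [hD, sub_eq_zero] using h
  have hclosed : IsClosed (LinearMap.ker D.toLinearMap : Set C(Icc 0 T, ℝ)) := D.isClosed_ker
  have hmono (n : ℕ) : D (rpowMap T n.cast_nonneg) = 0 := by
    have := (Real.Gamma_pos_of_pos (show 0 < (n : ℝ) + 1 + ν by positivity)).ne'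
    simp only [hD, sub_apply, ContinuousLinearMap.comp_apply,
      fracOp_rpowMap hT hν, map_smul, fracOp_rpowMap hT hμ, fracOp_rpowMap hT (add_nonneg hμ hν),
      sub_eq_zero]
    ext t
    simp only [smul_smul, ContinuousMap.smul_apply, rpowMap, restrictIcc_apply, smul_eq_mul]
    rw [show (n : ℝ) + ν + 1 = n + 1 + ν by ring, show (n : ℝ) + ν + μ = n + (μ + ν) by ring,
      show (n : ℝ) + 1 + ν + μ = n + 1 + (μ + ν) by ring]
    field_simp
  have hpoly : ∀ p : Polynomial ℝ,
      p.toContinuousMapOn (Icc 0 T) ∈ LinearMap.ker D.toLinearMap := fun p => by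
    induction p using Polynomial.induction_on' with
    | add p q hp hq =>
      have := add_mem hp hq
      convert this using 1
      ext t
      simp
    | monomial n a =>
      have h := (LinearMap.ker D.toLinearMap).smul_mem a (LinearMap.mem_ker.2 (hmono n))
      convert h using 1
      ext t
      simp [rpowMap, restrictIcc_apply]
  refine closure_minimal (s := (polynomialFunctions (Icc 0 T) : Set C(Icc 0 T, ℝ))) ?_ hclosed
    (continuousMap_mem_polynomialFunctions_closure 0 T f)
  rintro _ ⟨p, -, rfl⟩
  exact hpoly p

variable {F : Type*} [NormedAddCommGroup F] [NormedSpace ℝ F] [CompleteSpace F]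

/-- The semigroup property of fractional integration. -/
lemma fracOp_fracOp {μ ν : ℝ} (hμ : 0 ≤ μ) (hν : 0 ≤ ν) (f : C(Icc 0 T, F)) :
    fracOp hT μ (fracOp hT ν f) = fracOp hT (μ + ν) f := by
  ext t
  -- Functionals separate points and commute with fractional integration, which reduces the claim to
  -- scalar functions.
  refine (SeparatingDual.eq_iff_forall_dual_eq (R := ℝ)).2 fun φ => ?_
  have h := congrArg (fun u : C(Icc 0 T, ℝ) => u t)
    (fracOp_semigroup_real hT hμ hν (φ.compLeftContinuous ℝ _ f))
  simpa only [← compLeft_fracOp hT φ hν, ← compLeft_fracOp hT φ hμ,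
    ← compLeft_fracOp hT φ (add_nonneg hμ hν)] using! h

lemma fracOp_mul {μ ν : ℝ} (hμ : 0 ≤ μ) (hν : 0 ≤ ν) :
    fracOp (F := F) hT μ * fracOp hT ν = fracOp hT (μ + ν) :=
  ContinuousLinearMap.ext fun f => fracOp_fracOp hT hμ hν f

lemma fracOp_pow {ν : ℝ} (hν : 0 ≤ ν) (k : ℕ) :
    fracOp (F := F) hT ν ^ k = fracOp hT (k * ν) := by
  induction k with
  | zero => simp [fracOp_zero]
  | succ k ih =>
    rw [pow_succ, ih, fracOp_mul hT (by positivity) hν]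
    push_cast
    ring_nf

omit [CompleteSpace F] in
lemma fracOp_one_apply (f : C(Icc 0 T, F)) (t : Icc 0 T) :
    fracOp hT 1 f t = ∫ s in (0 : ℝ)..t, IccExtend hT f s := by
  rw [fracOp_apply hT zero_le_one, fracIntegral, if_neg one_ne_zero]
  simp

lemma hasDerivWithinAt_fracOp_one (f : C(Icc 0 T, F)) (t : Icc 0 T) :
    HasDerivWithinAt (IccExtend hT (fracOp hT 1 f)) (f t) (Icc 0 T) t := by
  -- The constant extension of `f` is continuous on the whole line, so the endpoints of `[0, T]`
  -- need no special care.
  have h := (intervalIntegral.integral_hasDerivAt_right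
    (f.continuous.Icc_extend' (h := hT).intervalIntegrable 0 t)
    (f.continuous.Icc_extend' (h := hT)).stronglyMeasurable.stronglyMeasurableAtFilter
    (f.continuous.Icc_extend' (h := hT)).continuousAt).hasDerivWithinAt (s := Icc 0 T)
  rw [IccExtend_val] at h
  refine h.congr_of_mem (fun s hs => ?_) t.2
  rw [IccExtend_of_mem _ _ hs, fracOp_one_apply]

/-- The fundamental theorem of calculus, in terms of `fracOp hT 1`. -/
lemma eq_const_add_fracOp_one {f : ℝ → F} (hf : ContinuousOn f (Icc 0 T)) (f' : C(Icc 0 T, F))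
    (hf' : ∀ t : Icc 0 T, (t : ℝ) ∈ Ioo 0 T → HasDerivWithinAt f (f' t) (Icc 0 T) t) :
    restrictIcc f hf = ContinuousMap.const _ (f 0) + fracOp hT 1 f' := by
  ext t
  rw [ContinuousMap.add_apply, fracOp_one_apply, ContinuousMap.const_apply, restrictIcc_apply,
    intervalIntegral.integral_eq_sub_of_hasDerivAt_of_le t.2.1 (f := f)
      (hf.mono (Icc_subset_Icc_right t.2.2)) (fun s hs => ?_)
      (f'.continuous.Icc_extend'.intervalIntegrable _ _)]
  · abel
  · have hs' : s ∈ Ioo 0 T := ⟨hs.1, hs.2.trans_le t.2.2⟩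
    rw [IccExtend_of_mem _ _ (Ioo_subset_Icc_self hs')]
    exact (hf' ⟨s, Ioo_subset_Icc_self hs'⟩ hs').hasDerivAt (Icc_mem_nhds hs'.1 hs'.2)

end Semigroup

/-! ### Growth of Gamma and convergence of the scalar double series -/

section MittagLefflerBound

/-- Keep only the piece over `(R, R + 1]` of the Gamma integral and bound `e^(-s) s^x / s` below
factor by factor. As `R` is arbitrary, Gamma beats every exponential. -/
lemma rpow_mul_le_Gamma {R x : ℝ} (hR : 0 < R) (hx : 0 < x) :
    Real.exp (-(R + 1)) / (R + 1) * R ^ x ≤ Real.Gamma x := by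
  rw [Real.Gamma_eq_integral hx]
  have hint := Real.GammaIntegral_convergent hx
  have hsub : Ioc R (R + 1) ⊆ Ioi (0 : ℝ) := fun s hs => hR.trans hs.1
  calc Real.exp (-(R + 1)) / (R + 1) * R ^ x
      = ∫ _ in Ioc R (R + 1), Real.exp (-(R + 1)) / (R + 1) * R ^ x := by
        rw [setIntegral_const]; simp
    _ ≤ ∫ s in Ioc R (R + 1), Real.exp (-s) * s ^ (x - 1) := by
        refine setIntegral_mono_on (integrableOn_const (by simp)) (hint.mono_set hsub) measurableSet_Ioc fun s hs => ?_
        have hs0 : 0 < s := hR.trans hs.1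
        rw [Real.rpow_sub_one hs0.ne', div_mul_eq_mul_div, mul_div_assoc]
        gcongr
        · exact hs.2
        · exact hs.1.le
        · exact hs.2
    _ ≤ ∫ s in Ioi 0, Real.exp (-s) * s ^ (x - 1) := by
        refine setIntegral_mono_set hint ?_ hsub.eventuallyLE
        filter_upwards [ae_restrict_mem measurableSet_Ioi] with s hs
        exact mul_nonneg (Real.exp_pos _).le (Real.rpow_nonneg (le_of_lt hs) _)

lemma rpow_nat_mul_add {t a b : ℝ} (ht : 0 ≤ t) (ha : 0 ≤ a) (hb : 0 ≤ b) (k m : ℕ) :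
    t ^ (k * a + m * b) = (t ^ a) ^ k * (t ^ b) ^ m := by
  rw [Real.rpow_add_of_nonneg ht (by positivity) (by positivity), mul_comm (k : ℝ),
    mul_comm (m : ℝ), Real.rpow_mul_natCast ht, Real.rpow_mul_natCast ht]

/-- Convergence of the bivariate Mittag-Leffler series of nonnegative numbers. -/
lemma summable_bivariateML_real {p q a b c t : ℝ} (hp : 0 ≤ p) (hq : 0 ≤ q) (ha : 0 < a)
    (hb : 0 < b) (hc : 0 < c) (ht : 0 ≤ t) :
    Summable fun n : ℕ × ℕ => ((n.1 + n.2).choose n.2 : ℝ) *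
      (t ^ (n.1 * a + n.2 * b) / Real.Gamma (n.1 * a + n.2 * b + c)) * (p ^ n.1 * q ^ n.2) := by
  -- Of the factor 4, one 2 absorbs the binomial coefficient, at most `2^(k+m)`, and the other
  -- leaves geometric ratios `1/2`.
  obtain ⟨R, hR, hRa, hRb⟩ : ∃ R : ℝ, 0 < R ∧ 4 * p * t ^ a ≤ R ^ a ∧ 4 * q * t ^ b ≤ R ^ b :=
    ((Filter.eventually_gt_atTop 0).and
      (((tendsto_rpow_atTop ha).eventually_ge_atTop _).and
        ((tendsto_rpow_atTop hb).eventually_ge_atTop _))).exists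
  set K := Real.exp (-(R + 1)) / (R + 1) with hK
  have hK0 : 0 < K := by positivity
  have hgeo : Summable fun n : ℕ × ℕ => (1 / 2 : ℝ) ^ n.1 * (1 / 2 : ℝ) ^ n.2 :=
    (summable_geometric_of_lt_one (by norm_num) (by norm_num)).mul_of_nonneg
      (summable_geometric_of_lt_one (by norm_num) (by norm_num))
      (fun _ => by positivity) (fun _ => by positivity)
  refine Summable.of_nonneg_of_le (fun n => ?_) (fun n => ?_) (hgeo.mul_left (1 / (K * R ^ c)))
  · have : 0 < Real.Gamma (n.1 * a + n.2 * b + c) := Real.Gamma_pos_of_pos (by positivity)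
    positivity
  · obtain ⟨k, m⟩ := n
    have hG := rpow_mul_le_Gamma hR (show 0 < k * a + m * b + c by positivity)
    rw [Real.rpow_add hR, rpow_nat_mul_add hR.le ha.le hb.le, ← hK] at hG
    have hch : ((k + m).choose m : ℝ) ≤ 2 ^ k * 2 ^ m := by
      rw [← pow_add]; exact_mod_cast Nat.choose_le_two_pow _ _
    have h1 : (2 * p * t ^ a / R ^ a) ^ k ≤ (1 / 2) ^ k := by
      refine pow_le_pow_left₀ (by positivity) ?_ _
      rw [div_le_iff₀ (by positivity)]; linarith
    have h2 : (2 * q * t ^ b / R ^ b) ^ m ≤ (1 / 2) ^ m := by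
      refine pow_le_pow_left₀ (by positivity) ?_ _
      rw [div_le_iff₀ (by positivity)]; linarith
    simp only
    rw [rpow_nat_mul_add ht ha.le hb.le]
    calc _ ≤ (2 ^ k * 2 ^ m) * ((t ^ a) ^ k * (t ^ b) ^ m /
            (K * ((R ^ a) ^ k * (R ^ b) ^ m * R ^ c))) * (p ^ k * q ^ m) := by gcongr
      _ = 1 / (K * R ^ c) * ((2 * p * t ^ a / R ^ a) ^ k * (2 * q * t ^ b / R ^ b) ^ m) := by
          simp only [div_pow, mul_pow]
          field_simp
      _ ≤ _ := by gcongr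

end MittagLefflerBound

/-! ### Neumann series of a sum of two commuting operators -/

section NeumannSeries

/-- Sum along the antidiagonals `k + m = n`, where the binomial theorem applies. This gives
summability of the powers of `P + Q` without `‖P + Q‖ < 1`. -/
lemma hasSum_add_pow {R : Type*} [NormedRing R] [NormedAlgebra ℝ R] {P Q : R} (hPQ : Commute P Q)
    (hs : Summable fun n : ℕ × ℕ => ((n.1 + n.2).choose n.2 : ℝ) • (P ^ n.1 * Q ^ n.2)) :
    HasSum (fun n => (P + Q) ^ n)
      (∑' n : ℕ × ℕ, ((n.1 + n.2).choose n.2 : ℝ) • (P ^ n.1 * Q ^ n.2)) := by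
  have h := (Finset.HasAntidiagonal.sigmaAntidiagonalEquivProd (A := ℕ)).hasSum_iff.2 hs.hasSum
  refine h.sigma fun n => ?_
  have h2 := Finset.hasSum (Finset.HasAntidiagonal.antidiagonal n)
    (fun p : ℕ × ℕ => ((p.1 + p.2).choose p.2 : ℝ) • (P ^ p.1 * Q ^ p.2))
  have h3 : (P + Q) ^ n = ∑ p ∈ Finset.HasAntidiagonal.antidiagonal n,
      ((p.1 + p.2).choose p.2 : ℝ) • (P ^ p.1 * Q ^ p.2) := by
    rw [hPQ.add_pow']
    refine Finset.sum_congr rfl fun p hp => ?_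
    rw [← Finset.HasAntidiagonal.mem_antidiagonal.1 hp, Nat.choose_symm_add,
      ← Nat.cast_smul_eq_nsmul ℝ]
  rw [h3]
  exact h2

/-- The equation `x = f + (P + Q) x` for commuting operators `P`, `Q` whose double Neumann series
converges. -/
lemma exists_neumann {V : Type*} [NormedAddCommGroup V] [NormedSpace ℝ V] [CompleteSpace V]
    {P Q : V →L[ℝ] V} (hPQ : Commute P Q) {u : ℕ × ℕ → ℝ} (hu : Summable u) (hu0 : ∀ n, 0 ≤ u n)
    (hle : ∀ n f, ‖((n.1 + n.2).choose n.2 : ℝ) • (P ^ n.1 * Q ^ n.2) f‖ ≤ u n * ‖f‖) :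
    ∃ S : V → V, (∀ f x, x = f + (P x + Q x) ↔ x = S f) ∧
      ∀ f, HasSum (fun n : ℕ × ℕ => ((n.1 + n.2).choose n.2 : ℝ) • (P ^ n.1 * Q ^ n.2) f)
        (S f) := by
  have hs : Summable fun n : ℕ × ℕ => ((n.1 + n.2).choose n.2 : ℝ) • (P ^ n.1 * Q ^ n.2) :=
    Summable.of_norm_bounded hu fun n =>
      ContinuousLinearMap.opNorm_le_bound _ (hu0 n) fun f => hle n f
  have hp := hasSum_add_pow hPQ hs
  -- The sum of the powers is a two-sided inverse of `1 - (P + Q)`: `h1` gives uniqueness of the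
  -- solution, `h2` existence.
  have h1 := hp.summable.tsum_pow_mul_one_sub
  have h2 := hp.summable.one_sub_mul_tsum_pow
  rw [hp.tsum_eq] at h1 h2
  set S := ∑' n : ℕ × ℕ, ((n.1 + n.2).choose n.2 : ℝ) • (P ^ n.1 * Q ^ n.2)
  refine ⟨S, fun f x => ?_, fun f => hs.hasSum.mapL (ContinuousLinearMap.apply ℝ V f)⟩
  have h : x = f + (P x + Q x) ↔ (1 - (P + Q)) x = f := by
    rw [sub_apply, one_apply_eq_self, sub_eq_iff_eq_add, add_apply]
  rw [h]
  constructor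
  · rintro rfl
    exact (DFunLike.congr_fun h1 x).symm
  · rintro rfl
    exact DFunLike.congr_fun h2 f

end NeumannSeries

/-! ### The Volterra equation with two fractional orders -/

section VolterraSeries

variable {T : ℝ} (hT : 0 ≤ T) {Y : Type*} [NormedAddCommGroup Y] [NormedSpace ℝ Y]

/-- The operator on `C([0, T], Y)` acting pointwise by `L`. -/
abbrev pointwiseOp (T : ℝ) (L : Y →L[ℝ] Y) : C(Icc 0 T, Y) →L[ℝ] C(Icc 0 T, Y) :=
  L.compLeftContinuous ℝ (Icc 0 T)

lemma pointwiseOp_mul (L M : Y →L[ℝ] Y) :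
    pointwiseOp T (L * M) = pointwiseOp T L * pointwiseOp T M := rfl

lemma pointwiseOp_pow (L : Y →L[ℝ] Y) (k : ℕ) :
    pointwiseOp T (L ^ k) = pointwiseOp T L ^ k := by
  induction k with
  | zero => rfl
  | succ k ih => rw [pow_succ, pow_succ, pointwiseOp_mul, ih]

lemma norm_pointwiseOp_le (L : Y →L[ℝ] Y) : ‖pointwiseOp T L‖ ≤ ‖L‖ := by
  refine ContinuousLinearMap.opNorm_le_bound _ (norm_nonneg _) fun f => ?_
  rw [ContinuousMap.norm_le _ (by positivity)]
  exact fun t => (L.le_opNorm _).trans (by gcongr; exact f.norm_coe_le_norm t)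

lemma norm_pow_mul_pow_le (A B : Y →L[ℝ] Y) (k m : ℕ) : ‖A ^ k * B ^ m‖ ≤ ‖A‖ ^ k * ‖B‖ ^ m := by
  -- The exponent 0 is separate because the identity of a trivial space has norm 0.
  have hle (L : Y →L[ℝ] Y) (n : ℕ) : ‖L ^ n‖ ≤ ‖L‖ ^ n := by
    rcases n with _ | n
    · rw [pow_zero, pow_zero]
      exact ContinuousLinearMap.norm_id_le
    · exact norm_pow_le' _ n.succ_pos
  exact (norm_mul_le _ _).trans (by gcongr <;> exact hle _ _)

variable [CompleteSpace Y]

lemma pointwiseOp_mul_fracOp (L : Y →L[ℝ] Y) {ν : ℝ} (hν : 0 ≤ ν) :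
    pointwiseOp T L * fracOp hT ν = fracOp hT ν * pointwiseOp T L :=
  ContinuousLinearMap.ext fun f => compLeft_fracOp hT L hν f

variable {A B : Y →L[ℝ] Y} {a b : ℝ}

lemma commute_pointwiseOp_mul_fracOp {L M : Y →L[ℝ] Y} (hLM : Commute L M) {μ ν : ℝ}
    (hμ : 0 ≤ μ) (hν : 0 ≤ ν) :
    Commute (pointwiseOp T L * fracOp hT μ) (pointwiseOp T M * fracOp hT ν) := by
  have h1 : Commute (pointwiseOp T L) (pointwiseOp T M) := by
    rw [Commute, SemiconjBy, ← pointwiseOp_mul, ← pointwiseOp_mul, hLM.eq]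
  have h2 : Commute (fracOp (F := Y) hT μ) (fracOp hT ν) := by
    rw [Commute, SemiconjBy, fracOp_mul hT hμ hν, fracOp_mul hT hν hμ, add_comm]
  have h3 : Commute (pointwiseOp T L) (fracOp hT ν) := pointwiseOp_mul_fracOp hT L hν
  have h4 : Commute (pointwiseOp T M) (fracOp hT μ) := pointwiseOp_mul_fracOp hT M hμ
  exact (h1.mul_right h3).mul_left (Commute.mul_right h4.symm h2)

/-- All factors involved can be sorted by commutation, and the semigroup law merges the integrals
into one. Its order `k * a + m * b` is the exponent in the Mittag-Leffler series. -/
lemma pow_mul_pow_eq (ha : 0 ≤ a) (hb : 0 ≤ b) (k m : ℕ) :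
    (pointwiseOp T A * fracOp hT a) ^ k * (pointwiseOp T B * fracOp hT b) ^ m =
      pointwiseOp T (A ^ k * B ^ m) * fracOp hT (k * a + m * b) := by
  have hp1 : Commute (pointwiseOp T A) (fracOp hT a) := pointwiseOp_mul_fracOp hT A ha
  have hp2 : Commute (pointwiseOp T B) (fracOp hT b) := pointwiseOp_mul_fracOp hT B hb
  have hp3 : Commute (pointwiseOp T B) (fracOp hT a) := pointwiseOp_mul_fracOp hT B ha
  rw [hp1.mul_pow, hp2.mul_pow, mul_assoc, ← mul_assoc (fracOp hT a ^ k), ← (hp3.pow_pow m k).eq,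
    mul_assoc, ← mul_assoc (pointwiseOp T A ^ k), fracOp_pow hT ha, fracOp_pow hT hb,
    fracOp_mul hT (by positivity) (by positivity), pointwiseOp_mul, pointwiseOp_pow,
    pointwiseOp_pow]

/-- The Volterra equation `x = f + A I^a x + B I^b x` has exactly one continuous solution, given by
the double Neumann series. -/
lemma exists_volterra (hAB : Commute A B) (ha : 0 < a) (hb : 0 < b) :
    ∃ S : C(Icc 0 T, Y) → C(Icc 0 T, Y),
      (∀ f x, x = f + (pointwiseOp T A (fracOp hT a x) + pointwiseOp T B (fracOp hT b x)) ↔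
        x = S f) ∧
      ∀ f t, HasSum (fun n : ℕ × ℕ => ((n.1 + n.2).choose n.2 : ℝ) •
        (A ^ n.1 * B ^ n.2) (fracOp hT (n.1 * a + n.2 * b) f t)) (S f t) := by
  obtain ⟨S, hS1, hS2⟩ := exists_neumann
    (commute_pointwiseOp_mul_fracOp hT hAB ha.le hb.le)
    -- The parameter is `c = 1` because the norm bound for `I^ν` has `Γ(ν + 1)` in the denominator.
    (summable_bivariateML_real (norm_nonneg A) (norm_nonneg B) ha hb one_pos hT)
    (fun n => by
      have : 0 < Real.Gamma (n.1 * a + n.2 * b + 1) := Real.Gamma_pos_of_pos (by positivity)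
      positivity) fun n f => by
      have h0 : 0 ≤ n.1 * a + n.2 * b := by positivity
      have h1 : ‖pointwiseOp T (A ^ n.1 * B ^ n.2)‖ ≤ ‖A‖ ^ n.1 * ‖B‖ ^ n.2 :=
        (norm_pointwiseOp_le _).trans (norm_pow_mul_pow_le A B _ _)
      have h2 := norm_fracOp_le (F := Y) hT h0
      rw [pow_mul_pow_eq hT ha.le hb.le, norm_smul, Real.norm_of_nonneg (by positivity), mul_assoc,
        mul_assoc]
      refine mul_le_mul_of_nonneg_left ?_ (by positivity)
      calc ‖pointwiseOp T (A ^ n.1 * B ^ n.2) (fracOp hT (n.1 * a + n.2 * b) f)‖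
          ≤ ‖pointwiseOp T (A ^ n.1 * B ^ n.2)‖ * (‖fracOp (F := Y) hT (n.1 * a + n.2 * b)‖ * ‖f‖) :=
            (ContinuousLinearMap.le_opNorm _ _).trans
              (mul_le_mul_of_nonneg_left (ContinuousLinearMap.le_opNorm _ _) (norm_nonneg _))
        _ ≤ (‖A‖ ^ n.1 * ‖B‖ ^ n.2) * (T ^ (n.1 * a + n.2 * b) /
              Real.Gamma (n.1 * a + n.2 * b + 1) * ‖f‖) := by gcongr
        _ = _ := by ring
  refine ⟨S, hS1, fun f t => ?_⟩
  have h := (hS2 f).mapL (ContinuousMap.evalCLM ℝ t)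
  simp only [pow_mul_pow_eq hT ha.le hb.le] at h
  exact h

end VolterraSeries

/-! ### The operator-valued bivariate Mittag-Leffler function -/

section BivariateML

variable {Y : Type*} [NormedAddCommGroup Y] [NormedSpace ℝ Y]
  {A B : Y →L[ℝ] Y} {a b c t T : ℝ}

/-- The bound for the terms of the bivariate Mittag-Leffler series on `[0, T]`. -/
def bivariateMLBound (A B : Y →L[ℝ] Y) (a b c T : ℝ) (n : ℕ × ℕ) : ℝ :=
  ((n.1 + n.2).choose n.2 : ℝ) *
    (T ^ (n.1 * a + n.2 * b) / Real.Gamma (n.1 * a + n.2 * b + c)) * (‖A‖ ^ n.1 * ‖B‖ ^ n.2)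

lemma summable_bivariateMLBound (ha : 0 < a) (hb : 0 < b) (hc : 0 < c) (hT : 0 ≤ T) :
    Summable (bivariateMLBound A B a b c T) :=
  summable_bivariateML_real (norm_nonneg A) (norm_nonneg B) ha hb hc hT

lemma norm_bivariateMLTerm_le (ha : 0 < a) (hb : 0 < b) (hc : 0 < c) (ht : t ∈ Icc 0 T)
    (n : ℕ × ℕ) : ‖bivariateMLTerm A B a b c t n.1 n.2‖ ≤ bivariateMLBound A B a b c T n := by
  have hG : 0 < Real.Gamma (n.1 * a + n.2 * b + c) := Real.Gamma_pos_of_pos (by positivity)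
  have h0 := Real.rpow_nonneg ht.1 (n.1 * a + n.2 * b)
  rw [bivariateMLTerm, norm_smul, Real.norm_of_nonneg (by positivity), bivariateMLBound]
  have h1 := Real.rpow_le_rpow ht.1 ht.2 (show 0 ≤ n.1 * a + n.2 * b by positivity)
  have h2 := norm_pow_mul_pow_le A B n.1 n.2
  have h3 := h0.trans h1
  gcongr

lemma summable_norm_bivariateMLTerm (ha : 0 < a) (hb : 0 < b) (hc : 0 < c) (ht : 0 ≤ t) :
    Summable fun n : ℕ × ℕ => ‖bivariateMLTerm A B a b c t n.1 n.2‖ :=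
  (summable_bivariateMLBound ha hb hc ht).of_nonneg_of_le (fun _ => norm_nonneg _)
    fun n => norm_bivariateMLTerm_le ha hb hc ⟨ht, le_rfl⟩ n

lemma continuous_bivariateMLTerm (ha : 0 < a) (hb : 0 < b) (k m : ℕ) :
    Continuous fun t => bivariateMLTerm A B a b c t k m := by
  unfold bivariateMLTerm
  exact (continuous_const.mul ((Real.continuous_rpow_const (by positivity)).div_const _)).smul
    continuous_const

variable [CompleteSpace Y]

lemma hasSum_bivariateML (ha : 0 < a) (hb : 0 < b) (hc : 0 < c) (ht : 0 ≤ t) :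
    HasSum (fun n : ℕ × ℕ => bivariateMLTerm A B a b c t n.1 n.2) (bivariateML A B a b c t) := by
  have h := (summable_norm_bivariateMLTerm (A := A) (B := B) ha hb hc ht).of_norm
  rw [bivariateML, ← h.tsum_prod (f := fun n : ℕ × ℕ => bivariateMLTerm A B a b c t n.1 n.2)]
  exact h.hasSum

lemma continuousOn_bivariateML (ha : 0 < a) (hb : 0 < b) (hc : 0 < c) (hT : 0 ≤ T) :
    ContinuousOn (bivariateML A B a b c) (Icc 0 T) := by
  have h := continuousOn_tsum (s := Icc 0 T)
    (f := fun (n : ℕ × ℕ) t => bivariateMLTerm A B a b c t n.1 n.2)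
    (fun n => (continuous_bivariateMLTerm ha hb n.1 n.2).continuousOn)
    (summable_bivariateMLBound ha hb hc hT)
    (fun n t ht => norm_bivariateMLTerm_le ha hb hc ht n)
  exact h.congr fun t ht => (hasSum_bivariateML ha hb hc ht.1).tsum_eq.symm

/-- The Neumann series produces `B` to the right of the Mittag-Leffler function, the closed formula
has it to the left. -/
lemma commute_bivariateML (hAB : Commute A B) (ha : 0 < a) (hb : 0 < b) (hc : 0 < c)
    (ht : 0 ≤ t) : Commute B (bivariateML A B a b c t) := by
  have h := hasSum_bivariateML (A := A) (B := B) ha hb hc ht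
  have h1 := h.mul_left B
  have h2 := h.mul_right B
  refine h1.unique ?_
  convert h2 using 2 with n
  rw [bivariateMLTerm, mul_smul_comm, smul_mul_assoc]
  congr 1
  exact ((hAB.symm.pow_right n.1).mul_right (Commute.pow_right (Commute.refl B) n.2)).eq

lemma continuousOn_convolution (ha : 0 < a) (hb : 0 < b) (hc : 1 ≤ c) {g : ℝ → Y}
    (ht : 0 ≤ t) (hg : ContinuousOn g (Icc 0 t)) :
    ContinuousOn (fun s => (t - s) ^ (c - 1) • bivariateML A B a b c (t - s) (g s)) (Icc 0 t) := by
  have hsub : ContinuousOn (fun s : ℝ => t - s) (Icc 0 t) := by fun_prop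
  refine ContinuousOn.smul ?_ (ContinuousOn.clm_apply ?_ hg)
  · exact hsub.rpow_const fun s _ => Or.inr (by linarith)
  · exact (continuousOn_bivariateML ha hb (by linarith) ht).comp hsub
      fun s hs => ⟨by linarith [hs.2], by linarith [hs.1]⟩

/-- With `ν = k * a + m * b`, the kernel of `I^(ν+c)` splits as `(t-s)^(c-1)` times `(t-s)^ν /
Γ(ν+c)`, the latter being the scalar part of one Mittag-Leffler term. -/
lemma fracIntegral_bivariateMLTerm (ha : 0 < a) (hb : 0 < b) (hc : 1 ≤ c) {g : ℝ → Y}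
    (hg : Continuous g) (ht : 0 ≤ t) (k m : ℕ) :
    ((k + m).choose m : ℝ) • (A ^ k * B ^ m) (fracIntegral (k * a + m * b + c) g t) =
      ∫ s in (0 : ℝ)..t, (t - s) ^ (c - 1) • bivariateMLTerm A B a b c (t - s) k m (g s) := by
  have hν : 0 ≤ k * a + m * b := by positivity
  have hcont : Continuous fun s => (t - s) ^ (k * a + m * b + c - 1) • g s :=
    ((continuous_const.sub continuous_id).rpow_const fun s => Or.inr (by linarith)).smul hg
  rw [fracIntegral, if_neg (by linarith), map_smul,
    ← ContinuousLinearMap.intervalIntegral_comp_comm _ (hcont.intervalIntegrable 0 t), smul_smul,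
    ← intervalIntegral.integral_smul]
  refine intervalIntegral.integral_congr fun s hs => ?_
  rw [uIcc_of_le ht] at hs
  simp only [bivariateMLTerm, smul_apply, map_smul, smul_smul]
  rw [add_sub_assoc, Real.rpow_add_of_nonneg (sub_nonneg.2 hs.2) hν (by linarith)]
  congr 1
  ring

/-- Sum and integral are exchanged by dominated convergence; since `c ≥ 1` the kernel is bounded, so
constants dominate the terms. -/
lemma hasSum_integral_bivariateMLTerm (ha : 0 < a) (hb : 0 < b) (hc : 1 ≤ c) {g : ℝ → Y}
    (hg : Continuous g) (ht : 0 ≤ t) :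
    HasSum (fun n : ℕ × ℕ =>
      ∫ s in (0 : ℝ)..t, (t - s) ^ (c - 1) • bivariateMLTerm A B a b c (t - s) n.1 n.2 (g s))
      (∫ s in (0 : ℝ)..t, (t - s) ^ (c - 1) • bivariateML A B a b c (t - s) (g s)) := by
  have hc0 : 0 < c := by linarith
  obtain ⟨M, hM⟩ := (isCompact_Icc (a := (0 : ℝ)) (b := t)).exists_bound_of_continuousOn
    hg.continuousOn
  refine intervalIntegral.hasSum_integral_of_dominated_convergence
    (fun n _ => t ^ (c - 1) * (bivariateMLBound A B a b c t n * M)) (fun n => ?_) (fun n => ?_)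
    ?_ ?_ ?_
  · refine Continuous.aestronglyMeasurable ?_
    exact ((continuous_const.sub continuous_id).rpow_const fun s => Or.inr (by linarith)).smul
      (((continuous_bivariateMLTerm ha hb n.1 n.2).comp
        (continuous_const.sub continuous_id)).clm_apply hg)
  · refine Filter.Eventually.of_forall fun s hs => ?_
    rw [uIoc_of_le ht] at hs
    have hs' : t - s ∈ Icc 0 t := ⟨by linarith [hs.2], by linarith [hs.1]⟩
    rw [norm_smul, Real.norm_of_nonneg (Real.rpow_nonneg hs'.1 _)]
    have h1 := norm_bivariateMLTerm_le (A := A) (B := B) ha hb hc0 hs' n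
    have h2 := hM s (Ioc_subset_Icc_self hs)
    have h3 := Real.rpow_le_rpow hs'.1 hs'.2 (show 0 ≤ c - 1 by linarith)
    have h4 := Real.rpow_nonneg hs'.1 (c - 1)
    exact mul_le_mul h3 ((ContinuousLinearMap.le_opNorm _ _).trans
      (mul_le_mul h1 h2 (norm_nonneg _) ((norm_nonneg _).trans h1))) (norm_nonneg _) (h4.trans h3)
  · exact Filter.Eventually.of_forall fun s _ =>
      ((summable_bivariateMLBound ha hb hc0 ht).mul_right M).mul_left _
  · exact intervalIntegrable_const
  · refine Filter.Eventually.of_forall fun s hs => ?_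
    rw [uIoc_of_le ht] at hs
    exact ((hasSum_bivariateML ha hb hc0 (by linarith [hs.2])).mapL
      (ContinuousLinearMap.apply ℝ Y (g s))).const_smul _

end BivariateML

/-! ### Closed form and regularity of the Volterra solution -/

section Mild

variable {T : ℝ} (hT : 0 ≤ T) {Y : Type*} [NormedAddCommGroup Y] [NormedSpace ℝ Y]
  [CompleteSpace Y] {A B : Y →L[ℝ] Y} {a b : ℝ}

/-- The closed formula for the continuous solution of the Volterra equation in `Y`. -/
def mildFormula (A B : Y →L[ℝ] Y) (a b : ℝ) (η η' : Y) (g : ℝ → Y) (t : ℝ) : Y :=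
  η + t ^ b • B (bivariateML A B a b (b + 1) t η) + t • bivariateML A B a b 2 t η'
    + ∫ s in (0 : ℝ)..t, (t - s) ^ (b - 1) • bivariateML A B a b b (t - s) (g s)

/-- The Volterra equation of the Cauchy problem, in `C([0, T], Y)`. -/
def IsVolterraSolution (A B : Y →L[ℝ] Y) (a b : ℝ) (η η' : Y) (g x : C(Icc 0 T, Y)) : Prop :=
  x = ContinuousMap.const _ η + fracOp hT 1 (ContinuousMap.const _ η')
    + pointwiseOp T A (fracOp hT a (x - ContinuousMap.const _ η))
    + fracOp hT b (pointwiseOp T B x + g)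

/-- The forcing has three parts. Applying `I^ν` to `I^b (Bη)`, `I^1 η'` and `I^b g` gives the series
with parameters `c = b + 1`, `c = 2` and, under the integral, `c = b`. -/
lemma hasSum_neumann_mildFormula (hAB : Commute A B) (ha : 0 < a) (hb : 1 ≤ b) (η η' : Y)
    (g : C(Icc 0 T, Y)) (t : Icc 0 T) :
    HasSum (fun n : ℕ × ℕ => ((n.1 + n.2).choose n.2 : ℝ) •
        (A ^ n.1 * B ^ n.2) (fracOp hT (n.1 * a + n.2 * b)
          (fracOp hT b (pointwiseOp T B (ContinuousMap.const _ η) + g)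
            + fracOp hT 1 (ContinuousMap.const _ η')) t))
      (mildFormula A B a b η η' (IccExtend hT g) t - η) := by
  have hb0 : 0 < b := by linarith
  have h1 := ((hasSum_bivariateML (A := A) (B := B) ha hb0 (show 0 < b + 1 by linarith)
    t.2.1).mapL (ContinuousLinearMap.apply ℝ Y (B η))).const_smul ((t : ℝ) ^ b)
  have h2 := ((hasSum_bivariateML (A := A) (B := B) ha hb0 (show (0 : ℝ) < 2 by norm_num)
    t.2.1).mapL (ContinuousLinearMap.apply ℝ Y η')).const_smul (t : ℝ)
  have h3 := hasSum_integral_bivariateMLTerm (A := A) (B := B) ha hb0 hb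
    (g.continuous.Icc_extend' (h := hT)) t.2.1
  have h := (h1.add h2).add h3
  have hcomm : bivariateML A B a b (b + 1) t (B η) = B (bivariateML A B a b (b + 1) t η) :=
    (DFunLike.congr_fun
      (commute_bivariateML hAB ha hb0 (show 0 < b + 1 by linarith) t.2.1).eq η).symm
  simp only [ContinuousLinearMap.apply_apply, hcomm] at h
  rw [mildFormula, add_assoc, add_assoc, add_sub_cancel_left, ← add_assoc]
  convert h using 2 with n
  have hν : 0 ≤ n.1 * a + n.2 * b := by positivity
  have hB : pointwiseOp T B (ContinuousMap.const _ η) = ContinuousMap.const _ (B η) := rfl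
  rw [← fracIntegral_bivariateMLTerm ha hb0 hb (g.continuous.Icc_extend' (h := hT)) t.2.1,
    ← fracOp_apply hT (by positivity), map_add, fracOp_fracOp hT hν hb0.le,
    fracOp_fracOp hT hν zero_le_one, map_add, hB, ContinuousMap.add_apply, ContinuousMap.add_apply,
    fracOp_const_apply hT (by positivity), fracOp_const_apply hT (by positivity),
    Real.rpow_add_of_nonneg t.2.1 hν hb0.le, Real.rpow_add_of_nonneg t.2.1 hν zero_le_one,
    Real.rpow_one]
  simp only [bivariateMLTerm, map_add, map_smul, smul_add, smul_smul, smul_apply]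
  rw [add_right_comm]
  congr 3
  · rw [add_assoc]
    ring
  · rw [add_assoc, one_add_one_eq_two]
    ring

/-- The unknown is shifted to `x - η`. The `A`-term already contains this difference, while the
`B`-term leaves `I^b (Bη)`, which joins the forcing. -/
lemma exists_isVolterraSolution_iff (hAB : Commute A B) (ha : 0 < a) (hb : 1 ≤ b) (η η' : Y)
    (g : C(Icc 0 T, Y)) :
    ∃ z : C(Icc 0 T, Y), (∀ t : Icc 0 T, z t = mildFormula A B a b η η' (IccExtend hT g) t) ∧
      ∀ x, IsVolterraSolution hT A B a b η η' g x ↔ x = z := by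
  have hb0 : 0 < b := by linarith
  obtain ⟨S, hS1, hS2⟩ := exists_volterra hT hAB ha hb0
  set c : C(Icc 0 T, Y) := ContinuousMap.const _ η with hc
  set f := fracOp hT b (pointwiseOp T B c + g) + fracOp hT 1 (ContinuousMap.const _ η') with hf
  refine ⟨S f + c, fun t => ?_, fun x => ?_⟩
  · rw [ContinuousMap.add_apply,
      (hS2 f t).unique (hasSum_neumann_mildFormula hT hAB ha hb η η' g t)]
    exact sub_add_cancel _ _
  · rw [← sub_eq_iff_eq_add, ← hS1, IsVolterraSolution, compLeft_fracOp hT B hb0.le, hf]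
    simp only [map_sub, map_add]
    rw [sub_eq_iff_eq_add]
    refine Eq.congr_right ?_
    abel

/-- A continuous solution of the Volterra equation is of class `C¹`, and its derivative solves the
differentiated equation. -/
lemma IsVolterraSolution.exists_derivative (ha : 0 < a) (hb : 1 < b) {η η' : Y}
    {g x : C(Icc 0 T, Y)} (hx : IsVolterraSolution hT A B a b η η' g x) :
    ∃ w : C(Icc 0 T, Y), x = ContinuousMap.const _ η + fracOp hT 1 w ∧
      w ⟨0, left_mem_Icc.2 hT⟩ = η' := by
  -- The candidate `w` for `x'` solves the formally differentiated equation, with `x` in the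
  -- `B`-term regarded as known. So the second operator is 0 and its order 1 is arbitrary.
  obtain ⟨S, hS1, -⟩ := exists_volterra hT (Commute.zero_right A) ha one_pos
  have h0 (f : C(Icc 0 T, Y)) : pointwiseOp T (0 : Y →L[ℝ] Y) f = 0 := rfl
  simp only [h0, add_zero] at hS1
  set f := ContinuousMap.const (Icc 0 T) η' + fracOp hT (b - 1) (pointwiseOp T B x + g) with hf
  have hw : S f = f + pointwiseOp T A (fracOp hT a (S f)) := (hS1 _ _).2 rfl
  set w := S f
  refine ⟨w, ?_, ?_⟩
  -- Both `I^1 w` and `x - η` solve the same Volterra equation with forcing `I^1 f`, so uniqueness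
  -- identifies them.
  · have h1 : fracOp hT 1 w = fracOp hT 1 f + pointwiseOp T A (fracOp hT a (fracOp hT 1 w)) := by
      conv_lhs => rw [hw]
      rw [map_add, ← compLeft_fracOp hT A zero_le_one, fracOp_fracOp hT zero_le_one ha.le,
        fracOp_fracOp hT ha.le zero_le_one, add_comm 1 a]
    have h2 : x - ContinuousMap.const _ η
        = fracOp hT 1 f + pointwiseOp T A (fracOp hT a (x - ContinuousMap.const _ η)) := by
      rw [sub_eq_iff_eq_add, hf, map_add, fracOp_fracOp hT zero_le_one (by linarith),
        add_sub_cancel]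
      conv_lhs => rw [hx]
      abel
    rw [← sub_eq_iff_eq_add', (hS1 _ _).1 h1, (hS1 _ _).1 h2]
  · have h3 (f : C(Icc 0 T, Y)) (t : Icc 0 T) : pointwiseOp T A f t = A (f t) := rfl
    rw [hw, hf, ContinuousMap.add_apply, ContinuousMap.add_apply, fracOp_apply_zero hT (by linarith),
      h3, fracOp_apply_zero hT ha]
    simp

end Mild

/-! ### `C¹` functions as primitives; injectivity of fractional integrals -/

section Primitive

variable {T : ℝ} (hT : 0 < T) {F : Type*} [NormedAddCommGroup F] [NormedSpace ℝ F]
  [CompleteSpace F]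

/-- On `[0, T]` the function `f` is the primitive of `w` with value `c` at `0`. -/
def IsPrimitive (f : ℝ → F) (c : F) (w : C(Icc 0 T, F)) : Prop :=
  ∀ t : Icc 0 T, f t = c + fracOp hT.le 1 w t

namespace IsPrimitive

variable {hT} {f : ℝ → F} {c : F} {w : C(Icc 0 T, F)}

lemma hasDerivWithinAt (h : IsPrimitive hT f c w) (t : Icc 0 T) :
    HasDerivWithinAt f (w t) (Icc 0 T) t := by
  refine ((hasDerivWithinAt_fracOp_one hT.le w t).const_add c).congr_of_mem (fun s hs => ?_) t.2
  rw [IccExtend_of_mem _ _ hs, ← h ⟨s, hs⟩]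

lemma derivWithin_eq (h : IsPrimitive hT f c w) (t : Icc 0 T) :
    derivWithin f (Icc 0 T) t = w t :=
  (h.hasDerivWithinAt t).derivWithin (uniqueDiffOn_Icc hT t t.2)

lemma continuousOn (h : IsPrimitive hT f c w) : ContinuousOn f (Icc 0 T) :=
  fun t ht => (h.hasDerivWithinAt ⟨t, ht⟩).continuousWithinAt

lemma contDiffOn (h : IsPrimitive hT f c w) : ContDiffOn ℝ 1 f (Icc 0 T) := by
  rw [← zero_add (1 : WithTop ℕ∞), contDiffOn_succ_iff_derivWithin (uniqueDiffOn_Icc hT)]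
  refine ⟨fun t ht => (h.hasDerivWithinAt ⟨t, ht⟩).differentiableWithinAt, by simp, ?_⟩
  rw [contDiffOn_zero]
  refine (w.continuous.Icc_extend' (h := hT.le)).continuousOn.congr fun t ht => ?_
  rw [IccExtend_of_mem _ _ ht, ← h.derivWithin_eq ⟨t, ht⟩]

omit [CompleteSpace F] in
lemma apply_zero (h : IsPrimitive hT f c w) : f 0 = c := by
  simpa [fracOp_apply_zero] using h ⟨0, left_mem_Icc.2 hT.le⟩

lemma restrictIcc_eq (h : IsPrimitive hT f c w) :
    restrictIcc f h.continuousOn = ContinuousMap.const _ c + fracOp hT.le 1 w :=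
  ContinuousMap.ext h

lemma comp_clm {G : Type*} [NormedAddCommGroup G] [NormedSpace ℝ G] [CompleteSpace G]
    (h : IsPrimitive hT f c w) (L : F →L[ℝ] G) {f' : ℝ → G}
    (hf' : ∀ t ∈ Icc 0 T, f' t = L (f t)) :
    IsPrimitive hT f' (L c) (L.compLeftContinuous ℝ _ w) := fun t => by
  rw [hf' t t.2, h t, map_add, ← compLeft_fracOp hT.le L zero_le_one]
  rfl

lemma congr_primitive {c' : F} {w' : C(Icc 0 T, F)} (h : IsPrimitive hT f c w)
    (h' : IsPrimitive hT f c' w') : c = c' ∧ w = w' :=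
  ⟨h.apply_zero.symm.trans h'.apply_zero,
    ContinuousMap.ext fun t => (h.derivWithin_eq t).symm.trans (h'.derivWithin_eq t)⟩

end IsPrimitive

lemma exists_isPrimitive {f : ℝ → F} (hf : ContDiffOn ℝ 1 f (Icc 0 T)) :
    ∃ hw : ContinuousOn (derivWithin f (Icc 0 T)) (Icc 0 T),
      IsPrimitive hT f (f 0) (restrictIcc (derivWithin f (Icc 0 T)) hw) := by
  have hw := hf.continuousOn_derivWithin (uniqueDiffOn_Icc hT) le_rfl
  refine ⟨hw, fun t => ?_⟩
  have h := eq_const_add_fracOp_one hT.le hf.continuousOn (restrictIcc _ hw)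
    fun t _ => (hf.differentiableOn one_ne_zero t t.2).hasDerivWithinAt
  exact DFunLike.congr_fun h t

/-- Applying `I^(1-ν)` leads to `I^1`, from which differentiation recovers the function. -/
lemma fracOp_injective {ν : ℝ} (hν₀ : 0 ≤ ν) (hν₁ : ν ≤ 1) :
    Function.Injective (fracOp (F := F) hT.le ν) := fun f g hfg => by
  have h : fracOp hT.le 1 f = fracOp hT.le 1 g := by
    have := congrArg (fracOp hT.le (1 - ν)) hfg
    rwa [fracOp_fracOp _ (by linarith) hν₀, fracOp_fracOp _ (by linarith) hν₀,
      sub_add_cancel] at this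
  have h1 : IsPrimitive hT (IccExtend hT.le (fracOp hT.le 1 f)) 0 f := fun t => by simp
  have h2 : IsPrimitive hT (IccExtend hT.le (fracOp hT.le 1 f)) 0 g := fun t => by simp [h]
  exact (h1.congr_primitive h2).2

end Primitive

/-! ### Caputo derivatives in terms of the first derivative -/

section Caputo

variable {T : ℝ} {hT : 0 < T} {F : Type*} [NormedAddCommGroup F] [NormedSpace ℝ F]
  [CompleteSpace F] {f : ℝ → F} {c : F} {w : C(Icc 0 T, F)} {ν : ℝ}

lemma natCeil_eq_one (h₀ : 0 < ν) (h₁ : ν ≤ 1) : ⌈ν⌉₊ = 1 :=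
  (Nat.ceil_eq_iff one_ne_zero).2 ⟨by simpa using h₀, by simpa using h₁⟩

lemma natCeil_eq_two (h₁ : 1 < ν) (h₂ : ν ≤ 2) : ⌈ν⌉₊ = 2 :=
  (Nat.ceil_eq_iff two_ne_zero).2 ⟨by simpa using h₁, by simpa using h₂⟩

/-- Since `f - f(0) = I^1 w`, the semigroup law moves `I^1` to the outside. Thus a `C¹` function has
a Caputo derivative of order `ν` everywhere. -/
lemma IsPrimitive.caputoPrimitive_of_le_one (h : IsPrimitive hT f c w) (h₀ : 0 < ν) (h₁ : ν ≤ 1) :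
    IsPrimitive hT (caputoPrimitive T ν f) 0 (fracOp hT.le (1 - ν) w) := fun t => by
  have hc : ContinuousOn (fun s => f s - c) (Icc 0 T) := h.continuousOn.sub continuousOn_const
  have hr : restrictIcc _ hc = fracOp hT.le 1 w := ContinuousMap.ext fun s => by
    rw [restrictIcc_apply, h s, add_sub_cancel_left]
  rw [zero_add, fracOp_fracOp _ zero_le_one (by linarith), add_comm,
    ← fracOp_fracOp _ (by linarith) zero_le_one, ← hr, fracOp_restrict_apply _ (by linarith) _ t.2,
    caputoPrimitive, natCeil_eq_one h₀ h₁]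
  simp [h.apply_zero]

lemma IsPrimitive.hasCaputoDerivAt_of_le_one (h : IsPrimitive hT f c w) (h₀ : 0 < ν) (h₁ : ν ≤ 1)
    (t : Icc 0 T) : HasCaputoDerivAt T ν f (fracOp hT.le (1 - ν) w t) t := by
  have hp := h.caputoPrimitive_of_le_one h₀ h₁
  rw [HasCaputoDerivAt, natCeil_eq_one h₀ h₁]
  refine ⟨by simpa using hp.continuousOn, ?_⟩
  simpa using hp.hasDerivWithinAt t

lemma IsPrimitive.hasCaputoDerivAt_unique (h : IsPrimitive hT f c w) (h₀ : 0 < ν) (h₁ : ν ≤ 1)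
    (t : Icc 0 T) {u : F} (hu : HasCaputoDerivAt T ν f u t) :
    u = fracOp hT.le (1 - ν) w t := by
  have h1 := (h.hasCaputoDerivAt_of_le_one h₀ h₁ t).2
  exact (uniqueDiffOn_Icc hT t t.2).eq_deriv _ hu.2 h1

/-- Subtracting the linear Taylor polynomial leaves `I^1 (w - w(0))`. This accounts for one of the
two derivatives; the second one need not exist for a `C¹` function. -/
lemma IsPrimitive.caputoPrimitive_of_le_two (h : IsPrimitive hT f c w) (h₁ : 1 < ν) (h₂ : ν ≤ 2) :
    IsPrimitive hT (caputoPrimitive T ν f) 0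
      (fracOp hT.le (2 - ν) (w - ContinuousMap.const _ (w ⟨0, left_mem_Icc.2 hT.le⟩))) :=
  fun t => by
  set e := w ⟨0, left_mem_Icc.2 hT.le⟩ with he
  have hc : ContinuousOn (fun s : ℝ => f s - (c + s • e)) (Icc 0 T) :=
    h.continuousOn.sub (by fun_prop)
  have hr : restrictIcc _ hc = fracOp hT.le 1 (w - ContinuousMap.const _ e) :=
    ContinuousMap.ext fun s => by
      rw [restrictIcc_apply, h s, map_sub, ContinuousMap.sub_apply,
        fracOp_const_apply _ zero_le_one]
      simp only [Real.rpow_one, one_add_one_eq_two, Real.Gamma_two, div_one]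
      abel
  rw [zero_add, fracOp_fracOp _ zero_le_one (by linarith), add_comm,
    ← fracOp_fracOp _ (by linarith) zero_le_one, ← hr, fracOp_restrict_apply _ (by linarith) _ t.2,
    caputoPrimitive, natCeil_eq_two h₁ h₂]
  have hd := h.derivWithin_eq ⟨0, left_mem_Icc.2 hT.le⟩
  simp only at hd
  simp [h.apply_zero, Finset.sum_range_succ, iteratedDerivWithin_one, hd, he]

/-- For `1 < ν ≤ 2` and `f` of class `C¹` the Caputo derivative of order `ν` is the derivative of
`I^(2 - ν) (f' - f' 0)`. -/
lemma IsPrimitive.hasCaputoDerivAt_iff (h : IsPrimitive hT f c w) (h₁ : 1 < ν) (h₂ : ν ≤ 2)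
    (t : Icc 0 T) (v : F) :
    HasCaputoDerivAt T ν f v t ↔ HasDerivWithinAt (IccExtend hT.le
      (fracOp hT.le (2 - ν) (w - ContinuousMap.const _ (w ⟨0, left_mem_Icc.2 hT.le⟩))))
      v (Icc 0 T) t := by
  have hp := h.caputoPrimitive_of_le_two h₁ h₂
  rw [HasCaputoDerivAt, natCeil_eq_two h₁ h₂]
  simp only [Nat.add_one_sub_one, Nat.cast_one, hp.contDiffOn, true_and]
  have heq : EqOn (iteratedDerivWithin 1 (caputoPrimitive T ν f) (Icc 0 T)) (IccExtend hT.le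
      (fracOp hT.le (2 - ν) (w - ContinuousMap.const _ (w ⟨0, left_mem_Icc.2 hT.le⟩))))
      (Icc 0 T) := fun s hs => by
    rw [iteratedDerivWithin_one, IccExtend_of_mem _ _ hs, ← hp.derivWithin_eq ⟨s, hs⟩]
  exact ⟨fun H => H.congr_of_mem heq.symm t.2, fun H => H.congr_of_mem heq t.2⟩

lemma IsPrimitive.caputoDeriv_of_le_one (h : IsPrimitive hT f c w) (h₀ : 0 < ν) (h₁ : ν ≤ 1)
    (t : Icc 0 T) : caputoDeriv T ν f t = fracOp hT.le (1 - ν) w t := by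
  rw [caputoDeriv, natCeil_eq_one h₀ h₁, Nat.cast_one, fracOp_apply _ (by linarith)]
  refine fracIntegral_congr (fun s hs => ?_) t.2
  rw [iteratedDerivWithin_one, IccExtend_of_mem _ _ hs, ← h.derivWithin_eq ⟨s, hs⟩]

lemma exists_isPrimitive_isPrimitive (hT : 0 < T) (hf : ContDiffOn ℝ 2 f (Icc 0 T)) :
    ∃ w z : C(Icc 0 T, F), IsPrimitive hT f (f 0) w ∧
      w = ContinuousMap.const _ (w ⟨0, left_mem_Icc.2 hT.le⟩) + fracOp hT.le 1 z ∧
      ∀ ν, 1 < ν → ν ≤ 2 → ∀ t : Icc 0 T, caputoDeriv T ν f t = fracOp hT.le (2 - ν) z t := by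
  obtain ⟨hw, hp⟩ := exists_isPrimitive hT (hf.of_le one_le_two)
  have hf' : ContDiffOn ℝ 1 (derivWithin f (Icc 0 T)) (Icc 0 T) :=
    hf.derivWithin (uniqueDiffOn_Icc hT) (by norm_num)
  obtain ⟨hz, hq⟩ := exists_isPrimitive hT hf'
  refine ⟨_, restrictIcc _ hz, hp, hq.restrictIcc_eq, fun ν h₁ h₂ t => ?_⟩
  rw [caputoDeriv, natCeil_eq_two h₁ h₂, fracOp_restrict_apply _ (by linarith) _ t.2, Nat.cast_two]
  refine fracIntegral_congr (fun s hs => ?_) t.2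
  rw [iteratedDerivWithin_succ]
  exact derivWithin_congr (fun r hr => by rw [iteratedDerivWithin_one])
    (by rw [iteratedDerivWithin_one])

end Caputo

/-! ### The differentiated Volterra equation -/

section Reduction

variable {T : ℝ} (hT : 0 < T) {Y : Type*} [NormedAddCommGroup Y] [NormedSpace ℝ Y]
  [CompleteSpace Y] {A B : Y →L[ℝ] Y} {α β : ℝ}

/-- The Volterra equation for a `C¹` function in terms of its derivative. -/
lemma isVolterraSolution_iff_derivative (hα : 1 ≤ α) (hβ : β ≤ 1)
    {η η' : Y} {g x w : C(Icc 0 T, Y)} (hx : x = ContinuousMap.const _ η + fracOp hT.le 1 w) :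
    IsVolterraSolution hT.le A B (α - β) α η η' g x ↔
      w - ContinuousMap.const _ η' = fracOp hT.le (α - 1)
        (pointwiseOp T A (fracOp hT.le (1 - β) w) + (pointwiseOp T B x + g)) := by
  -- The equations are compared after applying `I^1`; the `A`-term then has total order `α + (1 - β)
  -- = (α - β) + 1`, and `I^1 w = x - η`.
  have hinj := fracOp_injective (F := Y) hT zero_le_one le_rfl
  rw [← hinj.eq_iff, fracOp_fracOp _ zero_le_one (by linarith), add_sub_cancel, map_add, map_sub,
    ← compLeft_fracOp _ A (by linarith), fracOp_fracOp _ (by linarith) (by linarith),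
    show α + (1 - β) = α - β + 1 by ring, ← fracOp_fracOp _ (by linarith) zero_le_one,
    IsVolterraSolution]
  have h1 : x - ContinuousMap.const _ η = fracOp hT.le 1 w := by rw [hx, add_sub_cancel_left]
  rw [h1, sub_eq_iff_eq_add, ← h1, sub_eq_iff_eq_add]
  refine Eq.congr_right ?_
  abel

end Reduction

/-! ### The closed formula and its written-out series -/

section Series

variable {X Y : Type*} [NormedAddCommGroup X] [NormedSpace ℝ X]
  [NormedAddCommGroup Y] [NormedSpace ℝ Y] {A B : Y →L[ℝ] Y} {α β c t : ℝ} (J : Y →L[ℝ] X)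

lemma seriesTerm_eq (hα : 0 < α) (hβα : β < α) (hc : 1 ≤ c) (ht : 0 ≤ t) (k m : ℕ) :
    seriesTerm J A B α β c t m k m
      = t ^ (c - 1) • (J ∘L bivariateMLTerm A B (α - β) α c t k m) := by
  have hν : 0 ≤ k * (α - β) + m * α := by
    have := sub_pos.2 hβα
    positivity
  rw [seriesTerm, bivariateMLTerm, add_sub_assoc, Real.rpow_add_of_nonneg ht hν (by linarith),
    ContinuousLinearMap.comp_smul, smul_smul]
  congr 1
  ring

lemma seriesTerm_succ_eq (n k m : ℕ) :
    seriesTerm J A B α β c t (n + 1) k m = seriesTerm J A B α β c t n k m ∘L B := by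
  rw [seriesTerm, seriesTerm, ContinuousLinearMap.smul_comp, pow_succ]
  rfl

lemma summable_norm_seriesTerm (hα : 0 < α) (hβα : β < α) (hc : 1 ≤ c) (ht : 0 ≤ t) :
    Summable fun p : ℕ × ℕ => ‖seriesTerm J A B α β c t p.2 p.1 p.2‖ := by
  refine ((summable_norm_bivariateMLTerm (A := A) (B := B) (sub_pos.2 hβα) hα
    (show 0 < c by linarith) ht).mul_left (t ^ (c - 1) * ‖J‖)).of_nonneg_of_le
    (fun _ => norm_nonneg _) fun n => ?_
  have h0 := Real.rpow_nonneg ht (c - 1)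
  rw [seriesTerm_eq J hα hβα hc ht, norm_smul, Real.norm_of_nonneg h0, mul_assoc]
  gcongr
  exact ContinuousLinearMap.opNorm_comp_le _ _

lemma summable_norm_seriesTerm_succ (hα : 0 < α) (hβα : β < α) (hc : 1 ≤ c) (ht : 0 ≤ t) :
    Summable fun p : ℕ × ℕ => ‖seriesTerm J A B α β c t (p.2 + 1) p.1 p.2‖ := by
  refine ((summable_norm_seriesTerm (A := A) (B := B) J hα hβα hc ht).mul_right
    ‖B‖).of_nonneg_of_le (fun _ => norm_nonneg _) fun n => ?_
  rw [seriesTerm_succ_eq]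
  exact ContinuousLinearMap.opNorm_comp_le _ _

variable [CompleteSpace X] [CompleteSpace Y]

lemma tsum_seriesTerm (hα : 0 < α) (hβα : β < α) (hc : 1 ≤ c) (ht : 0 ≤ t) :
    ∑' k : ℕ, ∑' m : ℕ, seriesTerm J A B α β c t m k m
      = t ^ (c - 1) • (J ∘L bivariateML A B (α - β) α c t) := by
  have hs := (summable_norm_seriesTerm (A := A) (B := B) J hα hβα hc ht).of_norm
  rw [← hs.tsum_prod (f := fun p : ℕ × ℕ => seriesTerm J A B α β c t p.2 p.1 p.2)]
  have h := ((hasSum_bivariateML (A := A) (B := B) (sub_pos.2 hβα) hα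
    (show 0 < c by linarith) ht).mapL (ContinuousLinearMap.compL ℝ Y Y X J)).const_smul (t ^ (c - 1))
  refine Eq.trans (tsum_congr fun n => ?_) h.tsum_eq
  exact seriesTerm_eq J hα hβα hc ht n.1 n.2

lemma tsum_seriesTerm_succ (hAB : Commute A B) (hα : 0 < α) (hβα : β < α) (hc : 1 ≤ c)
    (ht : 0 ≤ t) :
    ∑' k : ℕ, ∑' m : ℕ, seriesTerm J A B α β c t (m + 1) k m
      = t ^ (c - 1) • (J ∘L B ∘L bivariateML A B (α - β) α c t) := by
  have hs := (summable_norm_seriesTerm (A := A) (B := B) J hα hβα hc ht).of_norm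
  have hs' := (summable_norm_seriesTerm_succ (A := A) (B := B) J hα hβα hc ht).of_norm
  have hB : B ∘L bivariateML A B (α - β) α c t = bivariateML A B (α - β) α c t ∘L B :=
    (commute_bivariateML hAB (sub_pos.2 hβα) hα (show 0 < c by linarith) ht).eq
  rw [hB, ← ContinuousLinearMap.comp_assoc, ← ContinuousLinearMap.smul_comp,
    ← tsum_seriesTerm J hα hβα hc ht,
    ← hs.tsum_prod (f := fun p : ℕ × ℕ => seriesTerm J A B α β c t p.2 p.1 p.2),
    ← hs'.tsum_prod (f := fun p : ℕ × ℕ => seriesTerm J A B α β c t (p.2 + 1) p.1 p.2)]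
  have h := hs.hasSum.mapL ((ContinuousLinearMap.compL ℝ Y Y X).flip B)
  exact (tsum_congr fun n => seriesTerm_succ_eq J _ _ _).trans h.tsum_eq

lemma mlFormula_eq_seriesFormula (hAB : Commute A B) (hα : 1 ≤ α) (hβα : β < α) (η η' : Y)
    (g : ℝ → Y) (ht : 0 ≤ t) :
    mlFormula J A B α β η η' g t = seriesFormula J A B α β η η' g t := by
  have hα0 : 0 < α := by linarith
  rw [mlFormula, seriesFormula, tsum_seriesTerm_succ J hAB hα0 hβα (by linarith) ht,
    tsum_seriesTerm J hα0 hβα one_le_two ht, add_sub_cancel_right,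
    show (2 : ℝ) - 1 = 1 by norm_num, Real.rpow_one]
  congr 1
  refine intervalIntegral.integral_congr fun s hs => ?_
  rw [uIcc_of_le ht] at hs
  rw [tsum_seriesTerm J hα0 hβα hα (sub_nonneg.2 hs.2)]
  rfl

/-- A bounded operator passes through the integral, so the formula in `X` is the image of the one in
`Y`. -/
lemma mlFormula_eq (hα : 1 ≤ α) (hβα : β < α) (η η' : Y) {g : ℝ → Y} (ht : 0 ≤ t)
    (hg : ContinuousOn g (Icc 0 t)) :
    mlFormula J A B α β η η' g t = J (mildFormula A B (α - β) α η η' g t) := by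
  have hc := continuousOn_convolution (A := A) (B := B) (sub_pos.2 hβα)
    (show 0 < α by linarith) hα ht hg
  have hi := ContinuousLinearMap.intervalIntegral_comp_comm J (a := 0) (b := t) (μ := volume)
    (hc.intervalIntegrable_of_Icc ht)
  rw [mlFormula, mildFormula, map_add, ← hi]
  simp

end Series

/-! ### Transfer to the operators `E`, `A₀`, `B₀` and the three solution concepts -/

section Sobolev

variable {X Y : Type*} [NormedAddCommGroup X] [NormedSpace ℝ X]
  [NormedAddCommGroup Y] [NormedSpace ℝ Y] {E A₀ B₀ : X →ₗ.[ℝ] Y}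

namespace SobolevHypotheses

lemma apply_invDomain (h : SobolevHypotheses E A₀ B₀) (z : Y) : E (h.invDomain z) = z :=
  (LinearEquiv.ofBijective E.toFun h.bijective_E).apply_symm_apply z

/-- This and the analogues for `A₀` and `B₀` turn domain and graph conditions into equations between
bounded operators on `Y`. -/
lemma mem_graph_iff (h : SobolevHypotheses E A₀ B₀) {u : X} {z : Y} :
    (u, z) ∈ E.graph ↔ u = h.inv z := by
  constructor
  · intro hu
    obtain ⟨v, hv, hz⟩ := (LinearPMap.mem_graph_iff E).1 hu
    simp only at hv hz
    rw [← hv, ← hz]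
    exact congrArg Subtype.val
      ((LinearEquiv.ofBijective E.toFun h.bijective_E).symm_apply_apply v).symm
  · rintro rfl
    exact (LinearPMap.mem_graph_iff E).2 ⟨h.invDomain z, rfl, h.apply_invDomain z⟩

lemma inv_injective (h : SobolevHypotheses E A₀ B₀) : Function.Injective h.inv :=
  Subtype.val_injective.comp h.invDomain.injective

lemma mem_graph_opB_iff (h : SobolevHypotheses E A₀ B₀) {z b : Y} :
    (h.inv z, b) ∈ B₀.graph ↔ b = h.opB z := by
  have hm : (h.inv z, h.opB z) ∈ B₀.graph := (LinearPMap.mem_graph_iff B₀).2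
    ⟨Submodule.inclusion h.domain_E_le_B₀ (h.invDomain z), rfl, rfl⟩
  exact ⟨fun hb => B₀.mem_graph_snd_inj hb hm rfl, fun hb => hb ▸ hm⟩

lemma mem_graph_opA_iff [CompleteSpace Y] (h : SobolevHypotheses E A₀ B₀) {z a : Y} :
    (h.inv z, a) ∈ A₀.graph ↔ a = h.opA z := by
  have hm : (h.inv z, h.opA z) ∈ A₀.graph := (LinearPMap.mem_graph_iff A₀).2
    ⟨Submodule.inclusion h.domain_E_le_A₀ (h.invDomain z), rfl, rfl⟩
  exact ⟨fun ha => A₀.mem_graph_snd_inj ha hm rfl, fun ha => ha ▸ hm⟩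

end SobolevHypotheses

variable [CompleteSpace X] [CompleteSpace Y] (h : SobolevHypotheses E A₀ B₀)
  {T α β : ℝ} {η η' : Y} {g : ℝ → Y}

lemma isVolterraSolution_restrictIcc_iff (hT : 0 < T) (hα : 0 ≤ α) (hβα : β ≤ α)
    {A B : Y →L[ℝ] Y} (hg : ContinuousOn g (Icc 0 T)) {x : ℝ → Y}
    (hx : ContinuousOn x (Icc 0 T)) :
    IsVolterraSolution hT.le A B (α - β) α η η' (restrictIcc g hg) (restrictIcc x hx) ↔
      ∀ t ∈ Icc 0 T, x t = η - (t ^ (α - β) / Real.Gamma (α - β + 1)) • A η + t • η'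
        + A (fracIntegral (α - β) x t) + fracIntegral α (fun r => B (x r) + g r) t := by
  have hαβ : 0 ≤ α - β := sub_nonneg.2 hβα
  have hBx : ContinuousOn (fun r => B (x r) + g r) (Icc 0 T) :=
    (B.continuous.comp_continuousOn hx).add hg
  have hr : pointwiseOp T B (restrictIcc x hx) + restrictIcc g hg = restrictIcc _ hBx := rfl
  rw [IsVolterraSolution, ContinuousMap.ext_iff, Subtype.forall]
  refine forall₂_congr fun t ht => ?_
  have hA (f : C(Icc 0 T, Y)) (s : Icc 0 T) : pointwiseOp T A f s = A (f s) := rfl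
  rw [hr]
  simp only [ContinuousMap.add_apply, hA, map_sub, ContinuousMap.sub_apply,
    fracOp_restrict_apply hT.le hα hBx ht, fracOp_restrict_apply hT.le hαβ hx ht,
    fracOp_const_apply hT.le zero_le_one, fracOp_const_apply hT.le hαβ, restrictIcc_apply,
    ContinuousMap.const_apply, map_smul, Real.rpow_one, one_add_one_eq_two, Real.Gamma_two, div_one]
  refine Eq.congr_right ?_
  abel

/-- The continuous solution of the Volterra equation, which represents the closed formula. -/
lemma exists_isVolterraSolution_iff_mlFormula (hT : 0 < T) (hcomm : Commute h.opA h.opB)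
    (hα : 1 ≤ α) (hβα : β < α) (η η' : Y) (hg : ContinuousOn g (Icc 0 T)) :
    ∃ z : C(Icc 0 T, Y),
      (∀ t : Icc 0 T, mlFormula h.inv h.opA h.opB α β η η' g t = h.inv (z t)) ∧
      ∀ x, IsVolterraSolution hT.le h.opA h.opB (α - β) α η η' (restrictIcc g hg) x ↔ x = z := by
  obtain ⟨z, hz, hz'⟩ := exists_isVolterraSolution_iff hT.le hcomm (sub_pos.2 hβα) hα η η'
    (restrictIcc g hg)
  refine ⟨z, fun t => ?_, hz'⟩
  rw [mlFormula_eq h.inv hα hβα η η' t.2.1 (hg.mono (Icc_subset_Icc_right t.2.2)), hz, mildFormula,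
    mildFormula]
  congr 2
  refine intervalIntegral.integral_congr fun s hs => ?_
  rw [uIcc_of_le t.2.1] at hs
  have hs' : s ∈ Icc 0 T := ⟨hs.1, hs.2.trans t.2.2⟩
  simp only [IccExtend_of_mem hT.le _ hs', restrictIcc_apply]

lemma isMildSolution_iff (hT : 0 < T) (hcomm : Commute h.opA h.opB)
    (hα : 1 ≤ α) (hβα : β < α) (hg : ContinuousOn g (Icc 0 T)) (y : ℝ → X) :
    IsMildSolution h T α β η η' g y ↔
      EqOn y (mlFormula h.inv h.opA h.opB α β η η' g) (Icc 0 T) := by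
  obtain ⟨z, hz, hz'⟩ := exists_isVolterraSolution_iff_mlFormula h hT hcomm hα hβα η η' hg
  constructor
  · rintro ⟨x, hx, hyx, hV⟩ t ht
    have := (hz' _).1 ((isVolterraSolution_restrictIcc_iff hT (by linarith) hβα.le hg hx).2 hV)
    rw [hyx t ht, hz ⟨t, ht⟩, ← this, restrictIcc_apply]
  · intro hy
    have hx : ContinuousOn (IccExtend hT.le z) (Icc 0 T) := z.continuous.Icc_extend'.continuousOn
    refine ⟨IccExtend hT.le z, hx, fun t ht => ?_,
      (isVolterraSolution_restrictIcc_iff hT (by linarith) hβα.le hg hx).1 ((hz' _).2 ?_)⟩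
    · rw [hy ht, hz ⟨t, ht⟩, IccExtend_of_mem _ _ ht]
    · ext t
      rw [restrictIcc_apply, IccExtend_val]

/-- With `w = x'`, the problem says that `q = I^(2-α)(w - η')` has derivative `v = A I^(1-β) w + Bx
+ g`, so `q = I^1 v = I^(2-α) I^(α-1) v`. Cancelling `I^(2-α)` leaves the differentiated Volterra
equation. -/
lemma isCaputoSolution_iff (hT : 0 < T) (hcomm : Commute h.opA h.opB) (hα₁ : 1 < α)
    (hα₂ : α ≤ 2) (hβ₀ : 0 < β) (hβ₁ : β ≤ 1) (hg : ContinuousOn g (Icc 0 T)) (y : ℝ → X) :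
    IsCaputoSolution E A₀ B₀ T α β η η' g y ↔
      EqOn y (mlFormula h.inv h.opA h.opB α β η η' g) (Icc 0 T) := by
  obtain ⟨z, hz, hz'⟩ := exists_isVolterraSolution_iff_mlFormula h hT hcomm hα₁.le
    (hβ₁.trans_lt hα₁) η η' hg
  have h0T : (0 : ℝ) ∈ Icc 0 T := left_mem_Icc.2 hT.le
  constructor
  · rintro ⟨x, hE, hx, hη, hη', heq⟩
    have hy : ∀ t ∈ Icc 0 T, y t = h.inv (x t) := fun t ht => h.mem_graph_iff.1 (hE t ht)
    obtain ⟨hw, hp⟩ := exists_isPrimitive hT hx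
    set w := restrictIcc _ hw
    have hx0 : x 0 = η := h.inv_injective ((hy 0 h0T).symm.trans (h.mem_graph_iff.1 hη))
    rw [hx0] at hp
    have hpy := hp.comp_clm h.inv hy
    have hw0 : w ⟨0, h0T⟩ = η' :=
      h.inv_injective ((hpy.derivWithin_eq ⟨0, h0T⟩).symm.trans (h.mem_graph_iff.1 hη'))
    set q := fracOp hT.le (2 - α) (w - ContinuousMap.const _ η') with hq
    set v := pointwiseOp T h.opA (fracOp hT.le (1 - β) w)
      + (pointwiseOp T h.opB (restrictIcc x hp.continuousOn) + restrictIcc g hg) with hv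
    -- For `α = 2` there is no integral and the value is `w(0) - η'`; otherwise the order is
    -- positive.
    have hq0 : q ⟨0, h0T⟩ = 0 := by
      rcases hα₂.eq_or_lt with rfl | hα₂
      · simp [hq, fracOp_zero, hw0]
      · exact fracOp_apply_zero hT.le (by linarith) _
    have hqv : q = fracOp hT.le 1 v := by
      have hcont : ContinuousOn (IccExtend hT.le q) (Icc 0 T) := q.continuous.Icc_extend'.continuousOn
      -- Since `q` is continuous on `[0, T]`, the equation is needed only at interior points.
      have hF := eq_const_add_fracOp_one hT.le hcont v fun t ht => by
        obtain ⟨u, v', a, b, hu, hv', ha, hb, he⟩ := heq t (Ioo_subset_Ioc_self ht)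
        rw [hp.hasCaputoDerivAt_iff hα₁ hα₂, hw0] at hv'
        have hu' : u = h.inv (fracOp hT.le (1 - β) w t) := by
          rw [hpy.hasCaputoDerivAt_unique hβ₀ hβ₁ t hu,
            ← compLeft_fracOp hT.le h.inv (by linarith)]
          rfl
        rw [hu', h.mem_graph_opA_iff] at ha
        rw [hy t t.2, h.mem_graph_opB_iff] at hb
        convert hv' using 1
        rw [sub_eq_iff_eq_add'.1 he, ha, hb]
        rfl
      rw [← zero_add (fracOp hT.le 1 v), ← show (ContinuousMap.const (Icc 0 T) (0 : Y)) = 0 from rfl]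
      convert hF using 1
      · ext t
        rw [restrictIcc_apply, IccExtend_val]
      · rw [IccExtend_of_mem _ _ h0T, hq0]
    have hV := (isVolterraSolution_iff_derivative hT hα₁.le hβ₁ (A := h.opA) (B := h.opB)
      (g := restrictIcc g hg) (η' := η') hp.restrictIcc_eq).2 (by
        refine fracOp_injective hT (ν := 2 - α) (by linarith) (by linarith) ?_
        rw [fracOp_fracOp _ (by linarith) (by linarith), show 2 - α + (α - 1) = 1 by ring]
        exact hqv)
    intro t ht
    rw [hy t ht, hz ⟨t, ht⟩, ← (hz' _).1 hV, restrictIcc_apply]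
  · intro hy
    have hV := (hz' z).2 rfl
    obtain ⟨w, hzw, hw0⟩ := hV.exists_derivative hT.le (sub_pos.2 (hβ₁.trans_lt hα₁)) hα₁
    have hp : IsPrimitive hT (IccExtend hT.le z) η w := fun t => by
      rw [IccExtend_val, hzw]
      rfl
    have hyx : ∀ t ∈ Icc 0 T, y t = h.inv (IccExtend hT.le z t) := fun t ht => by
      rw [hy ht, hz ⟨t, ht⟩, IccExtend_of_mem _ _ ht]
    have hpy := hp.comp_clm h.inv hyx
    have hVw := (isVolterraSolution_iff_derivative hT hα₁.le hβ₁ hzw).1 hV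
    refine ⟨IccExtend hT.le z, fun t ht => h.mem_graph_iff.2 (hyx t ht), hp.contDiffOn,
      h.mem_graph_iff.2 hpy.apply_zero, h.mem_graph_iff.2 ?_, fun t ht => ?_⟩
    · rw [hpy.derivWithin_eq ⟨0, h0T⟩, ← hw0]
      rfl
    · have ht' := Ioc_subset_Icc_self ht
      have hu := hpy.hasCaputoDerivAt_of_le_one hβ₀ hβ₁ ⟨t, ht'⟩
      rw [← compLeft_fracOp hT.le h.inv (by linarith)] at hu
      set v := pointwiseOp T h.opA (fracOp hT.le (1 - β) w)
        + (pointwiseOp T h.opB z + restrictIcc g hg) with hv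
      refine ⟨_, v ⟨t, ht'⟩, h.opA (fracOp hT.le (1 - β) w ⟨t, ht'⟩), h.opB (z ⟨t, ht'⟩), hu, ?_,
        h.mem_graph_opA_iff.2 rfl, ?_, ?_⟩
      · rw [hp.hasCaputoDerivAt_iff hα₁ hα₂ ⟨t, ht'⟩, hw0, hVw,
          fracOp_fracOp _ (by linarith) (by linarith), show 2 - α + (α - 1) = 1 by ring]
        exact hasDerivWithinAt_fracOp_one hT.le v ⟨t, ht'⟩
      · rw [hyx t ht', h.mem_graph_opB_iff, IccExtend_of_mem _ _ ht']
      · rw [sub_eq_iff_eq_add']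
        rfl

/-- With `x₂ = x''` the equation is `I^(2-α) x₂ = v`. Applying the injective `I^(α-1)` gives `w -
w(0) = I^(α-1) v`, again the differentiated Volterra equation. -/
lemma isC2Solution_iff (hT : 0 < T) (hcomm : Commute h.opA h.opB) (hα₁ : 1 < α)
    (hα₂ : α ≤ 2) (hβ₀ : 0 < β) (hβ₁ : β ≤ 1) (hg : ContinuousOn g (Icc 0 T)) (y : ℝ → X) :
    IsC2Solution E A₀ B₀ T α β η η' g y ↔
      (EqOn y (mlFormula h.inv h.opA h.opB α β η η' g) (Icc 0 T) ∧
        ContDiffOn ℝ 2 y (Icc 0 T) ∧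
        ∃ x : ℝ → Y, ContDiffOn ℝ 2 x (Icc 0 T) ∧ ∀ t ∈ Icc 0 T, (y t, x t) ∈ E.graph) := by
  obtain ⟨z, hz, hz'⟩ := exists_isVolterraSolution_iff_mlFormula h hT hcomm hα₁.le
    (hβ₁.trans_lt hα₁) η η' hg
  have h0T : (0 : ℝ) ∈ Icc 0 T := left_mem_Icc.2 hT.le
  suffices H : ∀ x : ℝ → Y, ContDiffOn ℝ 2 x (Icc 0 T) →
      (∀ t ∈ Icc 0 T, (y t, x t) ∈ E.graph) →
      (((y 0, η) ∈ E.graph ∧ (derivWithin y (Icc 0 T) 0, η') ∈ E.graph ∧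
        ∀ t ∈ Ioc 0 T, ∃ a b : Y, (caputoDeriv T β y t, a) ∈ A₀.graph ∧ (y t, b) ∈ B₀.graph ∧
          caputoDeriv T α x t - a = b + g t) ↔
        EqOn y (mlFormula h.inv h.opA h.opB α β η η' g) (Icc 0 T)) by
    constructor
    · rintro ⟨hy, x, hE, hx, h1⟩
      exact ⟨(H x hx hE).1 h1, hy, x, hx, hE⟩
    · rintro ⟨h1, hy, x, hx, hE⟩
      exact ⟨hy, x, hE, hx, (H x hx hE).2 h1⟩
  intro x hx hE
  have hy : ∀ t ∈ Icc 0 T, y t = h.inv (x t) := fun t ht => h.mem_graph_iff.1 (hE t ht)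
  obtain ⟨w, x₂, hp, hwx, hcap⟩ := exists_isPrimitive_isPrimitive hT hx
  have hpy := hp.comp_clm h.inv hy
  set xc := restrictIcc x hp.continuousOn with hxc
  set v := pointwiseOp T h.opA (fracOp hT.le (1 - β) w)
    + (pointwiseOp T h.opB xc + restrictIcc g hg) with hv
  have hEq : EqOn y (mlFormula h.inv h.opA h.opB α β η η' g) (Icc 0 T) ↔ xc = z := by
    constructor
    · intro H
      ext t
      exact h.inv_injective ((hy t t.2).symm.trans ((H t.2).trans (hz t)))
    · rintro H t ht
      rw [hy t ht, hz ⟨t, ht⟩, ← H, hxc, restrictIcc_apply]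
  have hcapy (t : Icc 0 T) : caputoDeriv T β y t = h.inv (fracOp hT.le (1 - β) w t) := by
    rw [hpy.caputoDeriv_of_le_one hβ₀ hβ₁, ← compLeft_fracOp hT.le h.inv (by linarith)]
    rfl
  have hpt (t : Icc 0 T) : (∃ a b : Y, (caputoDeriv T β y t, a) ∈ A₀.graph ∧ (y t, b) ∈ B₀.graph ∧
      caputoDeriv T α x t - a = b + g t) ↔ fracOp hT.le (2 - α) x₂ t = v t := by
    rw [hcapy, hcap α hα₁ hα₂, hy t t.2]
    simp only [h.mem_graph_opA_iff, h.mem_graph_opB_iff, exists_eq_left, exists_and_left,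
      sub_eq_iff_eq_add']
    rfl
  have hpt' : (∀ t ∈ Ioc 0 T, ∃ a b : Y, (caputoDeriv T β y t, a) ∈ A₀.graph ∧
      (y t, b) ∈ B₀.graph ∧ caputoDeriv T α x t - a = b + g t) ↔ fracOp hT.le (2 - α) x₂ = v := by
    constructor
    · intro H
      -- Both sides are continuous, so the equation extends from `(0, T]` to `t = 0`.
      have hcl : EqOn (IccExtend hT.le (fracOp hT.le (2 - α) x₂)) (IccExtend hT.le v)
          (closure (Ioc 0 T)) := by
        refine EqOn.closure (fun t ht => ?_) (ContinuousMap.continuous _).Icc_extend'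
          v.continuous.Icc_extend'
        have ht' := Ioc_subset_Icc_self ht
        rw [IccExtend_of_mem _ _ ht', IccExtend_of_mem _ _ ht']
        exact (hpt ⟨t, ht'⟩).1 (H t ht)
      rw [closure_Ioc hT.ne] at hcl
      ext t
      simpa using hcl t.2
    · exact fun H t ht => (hpt ⟨t, Ioc_subset_Icc_self ht⟩).2 (DFunLike.congr_fun H _)
  have hη : (y 0, η) ∈ E.graph ↔ x 0 = η := by
    rw [h.mem_graph_iff, hy 0 h0T, h.inv_injective.eq_iff]
  have hη' : (derivWithin y (Icc 0 T) 0, η') ∈ E.graph ↔ w ⟨0, h0T⟩ = η' := by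
    rw [h.mem_graph_iff, hpy.derivWithin_eq ⟨0, h0T⟩, ← h.inv_injective.eq_iff]
    rfl
  rw [hη, hη', hpt', hEq, ← hz']
  have hVol (hx0 : x 0 = η) (hw0 : w ⟨0, h0T⟩ = η') :
      IsVolterraSolution hT.le h.opA h.opB (α - β) α η η' (restrictIcc g hg) xc ↔
        fracOp hT.le (2 - α) x₂ = v := by
    rw [isVolterraSolution_iff_derivative hT hα₁.le hβ₁ (w := w) (hx0 ▸ hp.restrictIcc_eq), ← hv,
      ← (fracOp_injective hT (ν := α - 1) (by linarith) (by linarith)).eq_iff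
        (a := fracOp hT.le (2 - α) x₂) (b := v),
      fracOp_fracOp _ (by linarith) (by linarith), show α - 1 + (2 - α) = 1 by ring]
    refine Eq.congr_left ?_
    rw [sub_eq_iff_eq_add', ← hw0]
    exact hwx
  constructor
  · rintro ⟨hx0, hw0, H⟩
    exact (hVol hx0 hw0).2 H
  · intro hV
    -- The initial values are recovered here: a Volterra solution determines its value at 0 and its
    -- derivative, which must agree with those of `x`.
    obtain ⟨w', hxw', hw0'⟩ := hV.exists_derivative hT.le (sub_pos.2 (hβ₁.trans_lt hα₁)) hα₁
    have hp' : IsPrimitive hT x η w' := fun t => DFunLike.congr_fun hxw' t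
    obtain ⟨hx0, rfl⟩ := hp.congr_primitive hp'
    exact ⟨hx0, hw0', (hVol hx0 hw0').1 hV⟩

end Sobolev

end

theorem mainTheorem10 {X Y : Type*}
    [NormedAddCommGroup X] [NormedSpace ℝ X] [CompleteSpace X]
    [NormedAddCommGroup Y] [NormedSpace ℝ Y] [CompleteSpace Y]
    (E A₀ B₀ : X →ₗ.[ℝ] Y) (h : SobolevHypotheses E A₀ B₀)
    (hcomm : h.opA * h.opB = h.opB * h.opA)
    (T α β : ℝ) (hT : 0 < T) (hα₁ : 1 < α) (hα₂ : α ≤ 2) (hβ₀ : 0 < β) (hβ₁ : β ≤ 1)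
    (η η' : Y) (g : ℝ → Y) (hg : ContinuousOn g (Set.Icc 0 T)) :
    -- all the series converge absolutely in operator norm, and the integrand is integrable
    (∀ t ∈ Set.Icc 0 T,
      (∀ c ∈ ({α + 1, 2, α} : Set ℝ), Summable fun p : ℕ × ℕ =>
        ‖bivariateMLTerm h.opA h.opB (α - β) α c t p.1 p.2‖) ∧
      (Summable fun p : ℕ × ℕ =>
        ‖seriesTerm h.inv h.opA h.opB α β (α + 1) t (p.2 + 1) p.1 p.2‖) ∧
      (Summable fun p : ℕ × ℕ => ‖seriesTerm h.inv h.opA h.opB α β 2 t p.2 p.1 p.2‖) ∧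
      (Summable fun p : ℕ × ℕ => ‖seriesTerm h.inv h.opA h.opB α β α t p.2 p.1 p.2‖) ∧
      IntervalIntegrable (fun s => (t - s) ^ (α - 1) •
        h.inv (bivariateML h.opA h.opB (α - β) α α (t - s) (g s))) MeasureTheory.volume 0 t) ∧
    -- the two forms of the formula agree
    Set.EqOn (mlFormula h.inv h.opA h.opB α β η η' g)
      (seriesFormula h.inv h.opA h.opB α β η η' g) (Set.Icc 0 T) ∧
    -- the formula gives the mild solution, and it is the only one
    (∀ y : ℝ → X, IsMildSolution h T α β η η' g y ↔
      Set.EqOn y (mlFormula h.inv h.opA h.opB α β η η' g) (Set.Icc 0 T)) ∧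
    -- it is also the only solution of the Cauchy problem itself
    (∀ y : ℝ → X, IsCaputoSolution E A₀ B₀ T α β η η' g y ↔
      Set.EqOn y (mlFormula h.inv h.opA h.opB α β η η' g) (Set.Icc 0 T)) ∧
    -- the solutions of class `C²`
    (∀ y : ℝ → X, IsC2Solution E A₀ B₀ T α β η η' g y ↔
      (Set.EqOn y (mlFormula h.inv h.opA h.opB α β η η' g) (Set.Icc 0 T) ∧
        ContDiffOn ℝ 2 y (Set.Icc 0 T) ∧
        ∃ x : ℝ → Y, ContDiffOn ℝ 2 x (Set.Icc 0 T) ∧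
          ∀ t ∈ Set.Icc 0 T, (y t, x t) ∈ E.graph)) := by
  have hβα : β < α := hβ₁.trans_lt hα₁
  have hα₀ : 0 < α := by linarith
  refine ⟨fun t ht => ⟨fun c hc => ?_, ?_, ?_, ?_, ?_⟩, fun t ht => ?_,
    isMildSolution_iff h hT hcomm hα₁.le hβα hg,
    isCaputoSolution_iff h hT hcomm hα₁ hα₂ hβ₀ hβ₁ hg,
    isC2Solution_iff h hT hcomm hα₁ hα₂ hβ₀ hβ₁ hg⟩
  · have hc0 : 0 < c := by
      rcases hc with rfl | rfl | rfl <;> linarith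
    exact summable_norm_bivariateMLTerm (sub_pos.2 hβα) hα₀ hc0 ht.1
  · exact summable_norm_seriesTerm_succ h.inv hα₀ hβα (by linarith) ht.1
  · exact summable_norm_seriesTerm h.inv hα₀ hβα one_le_two ht.1
  · exact summable_norm_seriesTerm h.inv hα₀ hβα hα₁.le ht.1
  · have hc := h.inv.continuous.comp_continuousOn (continuousOn_convolution (A := h.opA)
      (B := h.opB) (sub_pos.2 hβα) hα₀ hα₁.le ht.1 (hg.mono (Set.Icc_subset_Icc_right ht.2)))
    refine ContinuousOn.intervalIntegrable_of_Icc ht.1 (hc.congr fun s _ => ?_)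
    exact (map_smul h.inv _ _).symm
  · exact mlFormula_eq_seriesFormula h.inv hcomm hα₁.le hβα η η' g ht.1
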